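/- Let $L=\{(x,y,z)\in\mathbb Z^3: x+y+z=0\}$ be the triangular lattice; its points are the vertices of the tiling of the plane $x+y+z=0$ by the smallest equilateral triangles with vertices in $L$ (the lattice triangles). A vector $\mathbf u\in L$ is primitive if it is not of the form $k\mathbf v$ with $\mathbf v\in L$ and $k>1$ an integer. A lax superbase of $L$ is a set $\{\pm\mathbf u,\pm\mathbf v,\pm\mathbf w\}$ of three primitive vectors, each defined only up to sign, such that any two of $\mathbf u,\mathbf v,\mathbf w$ form a basis of $L$ and $\pm\mathbf u\pm\mathbf v\pm\mathbf w=\mathbf 0$ for a suitable choice of signs. For a primitive vector $\mathbf u\in L$, consider the lattice triangles whose interior is met by the line segment from the origin $\mathbf 0$ to $\mathbf u$. Let $G(\mathbf u)$ be the bipartite graph with one white vertex for each of these triangles and one black vertex for each vertex of these triangles other than $\mathbf 0$ and $\mathbf u$, in which a black vertex and a white vertex are adjacent if and only if the corresponding lattice point is a vertex of the corresponding triangle. Let $M(\mathbf u)$ be the number of perfect matchings of $G(\mathbf u)$; if $\mathbf u$ is a shortest nonzero vector of $L$, put $M(\mathbf u)=1$. A Markoff triple is a triple $(x,y,z)$ of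 positive integers with $x^2+y^2+z^2=3xyz$, and a Markoff number is a positive integer that occurs in at least one Markoff triple. **Theorem.** If $\{\pm\mathbf u,\pm\mathbf v,\pm\mathbf w\}$ is a lax superbase of $L$, then $(M(\mathbf u),M(\mathbf v),M(\mathbf w))$ is a Markoff triple, and every Markoff triple arises in this way. In particular, if $\mathbf u$ is a primitive vector of $L$, then $M(\mathbf u)$ is a Markoff number, and every Markoff number equals $M(\mathbf u)$ for some primitive vector $\mathbf u$ of $L$. -/

import Mathlib

namespace MarkoffSnake

/-- The triangular lattice of all integer triples with coordinate sum zero. -/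
def TriLattice : Submodule ℤ (Fin 3 → ℤ) where
  carrier := {x | x 0 + x 1 + x 2 = 0}
  add_mem' := by
    intro a b ha hb
    simp only [Set.mem_ofPred_eq, Pi.add_apply] at *
    linarith
  zero_mem' := by simp
  smul_mem' := by
    intro c x hx
    simp only [Set.mem_ofPred_eq, Pi.smul_apply, smul_eq_mul] at *
    rw [← mul_add, ← mul_add, hx, mul_zero]

/-- A primitive vector is not a proper multiple of a lattice vector. -/
def IsPrimitive (u : TriLattice) : Prop :=
  ∀ (k : ℤ) (v : TriLattice), 1 < k → u ≠ k • v

/-- The vectors `u`, `v` form a basis of the lattice. -/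
def FormBasis (u v : TriLattice) : Prop :=
  ∃ b : Module.Basis (Fin 2) ℤ TriLattice, ⇑b = ![u, v]

/-- `{±u, ±v, ±w}` is a lax superbase: the three vectors are primitive, any two of them form a
basis of the lattice, and `±u ± v ± w = 0` for some choice of the signs. -/
def IsLaxSuperbase (u v w : TriLattice) : Prop :=
  IsPrimitive u ∧ IsPrimitive v ∧ IsPrimitive w ∧
  FormBasis u v ∧ FormBasis u w ∧ FormBasis v w ∧
  ∃ a b c : ℤˣ, a • u + b • v + c • w = 0

/-- The squared Euclidean length of a lattice vector. -/
def sqLength (u : TriLattice) : ℤ := ∑ i, (u : Fin 3 → ℤ) i ^ 2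

/-- The shortest nonzero vectors of the lattice. -/
def IsShortest (u : TriLattice) : Prop :=
  u ≠ 0 ∧ ∀ v : TriLattice, v ≠ 0 → sqLength u ≤ sqLength v

/-- The (vertex sets of the) smallest equilateral triangles, which tile the plane. -/
def IsLatticeTriangle (t : Finset TriLattice) : Prop :=
  t.card = 3 ∧ ∀ p ∈ t, ∀ q ∈ t, p ≠ q → IsShortest (p - q)

/-- A lattice point as a point of real space. -/
def toReal (p : TriLattice) : Fin 3 → ℝ := fun i => ((p : Fin 3 → ℤ) i : ℝ)

/-- The (relative) interior of a triangle: the points all of whose barycentric coordinates are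
positive. -/
def openTriangle (t : Finset TriLattice) : Set (Fin 3 → ℝ) :=
  {x | ∃ c : TriLattice → ℝ, (∀ p ∈ t, 0 < c p) ∧ ∑ p ∈ t, c p = 1 ∧
    x = ∑ p ∈ t, c p • toReal p}

/-- The lattice triangles that the segment from the origin to `u` passes through, that is,
whose interior it meets. -/
def stripTriangles (u : TriLattice) : Set (Finset TriLattice) :=
  {t | IsLatticeTriangle t ∧ (segment ℝ 0 (toReal u) ∩ openTriangle t).Nonempty}

/-- The vertices of the triangles in the strip. -/
def stripVertices (u : TriLattice) : Set TriLattice :=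
  {p | ∃ t ∈ stripTriangles u, p ∈ t}

/-- The bipartite graph with a black vertex for each point of `B`, a white vertex for each
triangle of `T`, and an edge for each incidence of a point with a triangle. -/
def incidenceGraph (B : Set TriLattice) (T : Set (Finset TriLattice)) : SimpleGraph (B ⊕ T) :=
  SimpleGraph.fromRel fun x y =>
    ∃ (p : B) (t : T), x = Sum.inl p ∧ y = Sum.inr t ∧ (p : TriLattice) ∈ (t : Finset TriLattice)

/-- The vertex-triangle incidence graph of the strip of `u`, with the two endpoints of the segment
deleted from the black vertices. -/
def snakeGraph (u : TriLattice) :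
    SimpleGraph (↥(stripVertices u \ {0, u}) ⊕ ↥(stripTriangles u)) :=
  incidenceGraph (stripVertices u \ {0, u}) (stripTriangles u)

open Classical in
/-- The number of perfect matchings of the snake graph of `u`; it is put equal to `1` by
convention for the shortest vectors. -/
noncomputable def M (u : TriLattice) : ℕ :=
  if IsShortest u then 1
  else {H : (snakeGraph u).Subgraph | H.IsPerfectMatching}.ncard

/-- Positive integers with `x² + y² + z² = 3xyz`. -/
def IsMarkoffTriple (x y z : ℕ) : Prop :=
  0 < x ∧ 0 < y ∧ 0 < z ∧ x ^ 2 + y ^ 2 + z ^ 2 = 3 * x * y * z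

/-- A number that occurs in at least one Markoff triple. -/
def IsMarkoffNumber (n : ℕ) : Prop :=
  ∃ x y z : ℕ, IsMarkoffTriple x y z ∧ (n = x ∨ n = y ∨ n = z)

end MarkoffSnake

namespace MarkoffSnake

/-! In the coordinates `pt p q`, with `p` and `q` positive and coprime, the segment from the origin
to `pt p q` crosses one lattice edge on each level line `x + y = k`, `0 < k < p + q`, and its strip
consists of the two triangles on each of these edges. How one crossed edge is followed by the next
is recorded by the interior letters of the Christoffel word of `(p, q)`. Removing triangles from the
end of the strip gives a two-state linear recursion for the matchings, one unimodular matrix per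
letter. The first and last letters of the word supply the boundary vectors, so the matching number
is the lower left entry of the product of matrices over the whole word
(`matchingCount_eq_cohnEntry`, `M_pt`).

The Christoffel word of a mediant is the concatenation of the words of its Farey parents, so the
matrices multiply (`cohn_add`). Cayley-Hamilton turns this multiplication into a three-term
recursion, under which the trace stays three times the lower left entry (`trace_cohn`). The
recursion on entries is then exactly the Vieta move on solutions of Markoff's equation, so every
Farey pair with its mediant gives a Markoff triple (`cohnEntry_markoff`).

Negation and rotation preserve `M` (`M_map`), which brings any superbase with a vector off the three
coordinate lines into one closed sextant up to sign. There it is a Farey pair with its mediant; a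
superbase without such a vector consists of shortest vectors and gives `(1, 1, 1)`. Conversely,
Vieta descent on the largest entry leads any other triple to `(1, 1, 2)`, and running the descent
backwards walks along Farey pairs (`exists_fareyPair`). -/

/-! ### Christoffel words and their matrices -/

/-- The letter of the (upper) Christoffel word of slope `p / n`. -/
def christoffelStep (p n k : ℕ) : Bool := decide (k * p / n < (k + 1) * p / n)

/-- The transfer matrices of the two letters. -/
def stepMatrix : Bool → Matrix (Fin 2) (Fin 2) ℤ
  | false => !![2, 1; 1, 1]
  | true => !![1, 1; 1, 2]

/-- The product of the transfer matrices of the first letters of a word. -/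
def wordMatrix (t : ℕ → Bool) : ℕ → Matrix (Fin 2) (Fin 2) ℤ
  | 0 => 1
  | k + 1 => wordMatrix t k * stepMatrix (t k)

/-- The matrix of the Christoffel word of `(p, q)`. -/
def cohn (p q : ℕ) : Matrix (Fin 2) (Fin 2) ℤ := wordMatrix (christoffelStep p (p + q)) (p + q)

/-- The Markoff number attached to `(p, q)`. -/
def cohnEntry (p q : ℕ) : ℤ := cohn p q 1 0

/-- The fraction on the left exceeds `k * p / n` by `k / (n * (n + n'))`, which is less than `1 / n`
and so cannot carry a fraction of denominator `n` to the next integer. -/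
lemma div_mediant_left {p n p' n' k : ℕ} (h : n * p' = p * n' + 1) (hn' : 0 < n') (hk : k ≤ n) :
    k * (p + p') / (n + n') = k * p / n := by
  have hn : 0 < n := by
    rcases Nat.eq_zero_or_pos n with h0 | h0
    · subst h0; omega
    · exact h0
  have hp' : 0 < p' := by
    rcases Nat.eq_zero_or_pos p' with h0 | h0
    · subst h0; omega
    · exact h0
  have h1 : k * p / n * n ≤ k * p := Nat.div_mul_le_self _ _
  have h2 : k * p < (k * p / n + 1) * n := by
    rw [mul_comm _ n]; exact Nat.lt_mul_div_succ _ hn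
  generalize k * p / n = c at *
  apply Nat.div_eq_of_lt_le
  · have : c * n' ≤ k * p' := by
      apply Nat.le_of_mul_le_mul_right _ hn
      nlinarith [Nat.mul_le_mul_right n' h1]
    linarith [mul_add c n n', mul_add k p p']
  · apply Nat.lt_of_mul_lt_mul_right (a := n)
    have h3 : (k * p + 1) * (n + n') ≤ (c + 1) * n * (n + n') := Nat.mul_le_mul_right _ h2
    have h4 : k * (n * p') = k * (p * n' + 1) := by rw [h]
    nlinarith

/-- Beyond the first `n` letters the excess over `p + j * p' / n'` is `(n' - j) / (n' * (n + n'))`,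
again nonnegative and less than `1 / n'`. -/
lemma div_mediant_right {p n p' n' j : ℕ} (h : n * p' = p * n' + 1) (hn' : 0 < n')
    (hj : j ≤ n') : (n + j) * (p + p') / (n + n') = p + j * p' / n' := by
  have hn : 0 < n := by
    rcases Nat.eq_zero_or_pos n with h0 | h0
    · subst h0; omega
    · exact h0
  have h1 : j * p' / n' * n' ≤ j * p' := Nat.div_mul_le_self _ _
  have h2 : j * p' + 1 ≤ (j * p' / n' + 1) * n' := by
    rw [mul_comm _ n']; exact Nat.lt_mul_div_succ _ hn'
  generalize j * p' / n' = c at *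
  have e : (n + j) * (p + p') = p * (n + n') + (1 + j * (p + p')) := by linarith
  have h4 : j * (n * p') = j * (p * n' + 1) := by rw [h]
  rw [e]
  apply Nat.div_eq_of_lt_le
  · have : c * (n + n') ≤ 1 + j * (p + p') := by
      apply Nat.le_of_mul_le_mul_right _ hn'
      have := Nat.mul_le_mul_right (n + n') h1
      nlinarith
    linarith
  · have : 1 + j * (p + p') < (c + 1) * (n + n') := by
      apply Nat.lt_of_mul_lt_mul_right (a := n')
      have := Nat.mul_le_mul_right (n + n') h2
      nlinarith
    linarith

/-- The two floor identities say that the word of the mediant is the word of `(p, q)` followed by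
that of `(p', q')`. -/
lemma cohn_add {p q p' q' : ℕ} (h : q * p' = p * q' + 1) :
    cohn (p + p') (q + q') = cohn p q * cohn p' q' := by
  have hn : (p + q) * p' = p * (p' + q') + 1 := by linarith
  have hn' : 0 < p' + q' := by
    rcases Nat.eq_zero_or_pos p' with h0 | h0
    · subst h0; omega
    · omega
  have e : p + p' + (q + q') = (p + q) + (p' + q') := by omega
  unfold cohn
  rw [e]
  generalize p + q = n at *
  generalize p' + q' = n' at *
  have left : ∀ k ≤ n, wordMatrix (christoffelStep (p + p') (n + n')) k =
      wordMatrix (christoffelStep p n) k := by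
    intro k hk
    induction k with
    | zero => rfl
    | succ k ih =>
      simp only [wordMatrix]
      rw [ih (by omega), christoffelStep, div_mediant_left hn hn' (by omega),
        div_mediant_left hn hn' (by omega)]
      rfl
  have right : ∀ j ≤ n', wordMatrix (christoffelStep (p + p') (n + n')) (n + j) =
      wordMatrix (christoffelStep p n) n * wordMatrix (christoffelStep p' n') j := by
    intro j hj
    induction j with
    | zero => simpa [wordMatrix] using left n le_rfl
    | succ j ih =>
      rw [← add_assoc]
      simp only [wordMatrix]
      rw [ih (by omega), mul_assoc, christoffelStep, div_mediant_right hn hn' (by omega),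
        add_assoc, div_mediant_right hn hn' (by omega)]
      simp [christoffelStep]
  exact right n' le_rfl

/-! ### Farey recursion, traces and Markoff's equation -/

/-- Subtracting the smaller vector of a pair from the larger keeps the determinant and lowers the
total of the coordinates. -/
lemma farey_induction {C : ℕ → ℕ → ℕ → ℕ → Prop} (base : C 0 1 1 0)
    (left : ∀ p q p' q', q * p' = p * q' + 1 → C p q p' q' → C p q (p + p') (q + q'))
    (right : ∀ p q p' q', q * p' = p * q' + 1 → C p q p' q' → C (p + p') (q + q') p' q') :
    ∀ p q p' q', q * p' = p * q' + 1 → C p q p' q' := by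
  suffices ∀ N p q p' q', p + q + p' + q' ≤ N → q * p' = p * q' + 1 → C p q p' q' from
    fun p q p' q' h => this _ p q p' q' le_rfl h
  intro N
  induction N with
  | zero =>
    intro p q p' q' hN h
    obtain rfl : q = 0 := by omega
    omega
  | succ N ih =>
    intro p q p' q' hN h
    have hq : 0 < q := Nat.pos_of_ne_zero (by rintro rfl; omega)
    have hp' : 0 < p' := Nat.pos_of_ne_zero (by rintro rfl; omega)
    by_cases h1 : p ≤ p' ∧ q ≤ q'
    · obtain ⟨a, rfl⟩ := Nat.exists_eq_add_of_le h1.1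
      obtain ⟨b, rfl⟩ := Nat.exists_eq_add_of_le h1.2
      have : q * a = p * b + 1 := by linarith
      exact left _ _ _ _ this (ih _ _ _ _ (by omega) this)
    by_cases h2 : p' ≤ p ∧ q' ≤ q
    · obtain ⟨a, rfl⟩ := Nat.exists_eq_add_of_le' h2.1
      obtain ⟨b, rfl⟩ := Nat.exists_eq_add_of_le' h2.2
      have : b * p' = a * q' + 1 := by linarith
      exact right _ _ _ _ this (ih _ _ _ _ (by omega) this)
    -- Incomparable vectors remain. The determinant decides which coordinates are larger, and then
    -- `q * p' ≥ (q' + 1) * (p + 1)` forces `p = q' = 0`.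
    have h3 : ¬ (p' < p ∧ q < q') := fun h3 => by
      have : q * p' ≤ q' * p := Nat.mul_le_mul h3.2.le h3.1.le
      linarith
    have h4 : q' + 1 ≤ q ∧ p + 1 ≤ p' := by omega
    have h5 : (q' + 1) * (p + 1) ≤ q * p' := Nat.mul_le_mul h4.1 h4.2
    have h6 : p = 0 ∧ q' = 0 := by
      constructor <;> nlinarith
    obtain ⟨rfl, rfl⟩ := h6
    have h7 : q * p' = 1 := by simpa using h
    obtain rfl : q = 1 := Nat.eq_one_of_mul_eq_one_right h7
    obtain rfl : p' = 1 := by simpa using h7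
    exact base

lemma det_wordMatrix (t : ℕ → Bool) (k : ℕ) : (wordMatrix t k).det = 1 := by
  induction k with
  | zero => simp [wordMatrix]
  | succ k ih =>
    rw [wordMatrix, Matrix.det_mul, ih]
    cases t k <;> simp [stepMatrix, Matrix.det_fin_two]

lemma det_cohn (p q : ℕ) : (cohn p q).det = 1 := det_wordMatrix _ _

lemma wordMatrix_pos (t : ℕ → Bool) (k : ℕ) (i j : Fin 2) : 0 < wordMatrix t (k + 1) i j := by
  induction k generalizing i j with
  | zero =>
    cases h : t 0 <;> fin_cases i <;> fin_cases j <;> simp [wordMatrix, stepMatrix, h]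
  | succ k ih =>
    rw [wordMatrix]
    have h0 := ih i 0
    have h1 := ih i 1
    simp only [Matrix.mul_apply, Fin.sum_univ_two]
    cases h : t (k + 1) <;> fin_cases j <;> simp [stepMatrix] <;> linarith

lemma cohnEntry_pos {p q : ℕ} (h : 0 < p + q) : 0 < cohnEntry p q := by
  unfold cohnEntry cohn
  obtain ⟨k, hk⟩ : ∃ k, p + q = k + 1 := ⟨p + q - 1, by omega⟩
  rw [hk]
  exact wordMatrix_pos _ _ _ _

/-- Cayley-Hamilton for `A`, multiplied by `B`. -/
lemma mul_mul_self_left {A B : Matrix (Fin 2) (Fin 2) ℤ} (h : A.det = 1) :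
    A * (A * B) = A.trace • (A * B) - B := by
  rw [Matrix.det_fin_two] at h
  ext i j
  simp only [Matrix.mul_apply, Fin.sum_univ_two, Matrix.sub_apply, Matrix.smul_apply,
    Matrix.trace_fin_two, smul_eq_mul]
  fin_cases i <;> simp only [Fin.zero_eta, Fin.mk_one]
  · linear_combination (-B 0 j) * h
  · linear_combination (-B 1 j) * h

lemma mul_mul_self_right {A B : Matrix (Fin 2) (Fin 2) ℤ} (h : B.det = 1) :
    A * B * B = B.trace • (A * B) - A := by
  rw [Matrix.det_fin_two] at h
  ext i j
  simp only [Matrix.mul_apply, Fin.sum_univ_two, Matrix.sub_apply, Matrix.smul_apply,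
    Matrix.trace_fin_two, smul_eq_mul]
  fin_cases j <;> simp only [Fin.zero_eta, Fin.mk_one]
  · linear_combination (-A i 0) * h
  · linear_combination (-A i 1) * h

lemma cohn_zero_one : cohn 0 1 = !![2, 1; 1, 1] := by
  simp [cohn, wordMatrix, christoffelStep, stepMatrix]

lemma cohn_one_zero : cohn 1 0 = !![1, 1; 1, 2] := by
  simp [cohn, wordMatrix, christoffelStep, stepMatrix]

/-- The trace of a Cohn matrix is three times its lower left entry, along a Farey pair. -/
lemma trace_cohn : ∀ p q p' q', q * p' = p * q' + 1 →
    (cohn p q).trace = 3 * cohnEntry p q ∧ (cohn p' q').trace = 3 * cohnEntry p' q' ∧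
    (cohn (p + p') (q + q')).trace = 3 * cohnEntry (p + p') (q + q') := by
  apply farey_induction
  · have : cohn (0 + 1) (1 + 0) = _ := cohn_add (p := 0) (q := 1) (p' := 1) (q' := 0) rfl
    unfold cohnEntry
    rw [this, cohn_zero_one, cohn_one_zero]
    simp [Matrix.trace_fin_two]
  · intro p q p' q' h ⟨h1, h2, h3⟩
    have e : cohn (p + (p + p')) (q + (q + q')) = cohn p q * cohn (p + p') (q + q') :=
      cohn_add (by linarith)
    refine ⟨h1, h3, ?_⟩
    unfold cohnEntry at *
    rw [cohn_add h] at *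
    -- The trace and the lower left entry obey the same linear recursion, so the ratio three passes
    -- from `A * B` and `B` to `A * (A * B)`.
    rw [e, mul_mul_self_left (det_cohn _ _), Matrix.trace_sub, Matrix.trace_smul, h3, h2]
    simp only [Matrix.sub_apply, Matrix.smul_apply, smul_eq_mul]; ring
  · intro p q p' q' h ⟨h1, h2, h3⟩
    have e : cohn (p + p' + p') (q + q' + q') = cohn (p + p') (q + q') * cohn p' q' :=
      cohn_add (by linarith)
    refine ⟨h3, h2, ?_⟩
    unfold cohnEntry at *
    rw [cohn_add h] at *
    rw [e, mul_mul_self_right (det_cohn _ _), Matrix.trace_sub, Matrix.trace_smul, h3, h1]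
    simp only [Matrix.sub_apply, Matrix.smul_apply, smul_eq_mul]; ring

lemma cohnEntry_add_left {p q p' q' : ℕ} (h : q * p' = p * q' + 1) :
    cohnEntry (p + (p + p')) (q + (q + q')) =
      3 * cohnEntry p q * cohnEntry (p + p') (q + q') - cohnEntry p' q' := by
  have e : cohn (p + (p + p')) (q + (q + q')) = cohn p q * cohn (p + p') (q + q') :=
    cohn_add (by linarith)
  have := (trace_cohn _ _ _ _ h).1
  unfold cohnEntry at *
  rw [e, cohn_add h, mul_mul_self_left (det_cohn _ _), this]
  simp only [Matrix.sub_apply, Matrix.smul_apply, smul_eq_mul]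

lemma cohnEntry_add_right {p q p' q' : ℕ} (h : q * p' = p * q' + 1) :
    cohnEntry (p + p' + p') (q + q' + q') =
      3 * cohnEntry p' q' * cohnEntry (p + p') (q + q') - cohnEntry p q := by
  have e : cohn (p + p' + p') (q + q' + q') = cohn (p + p') (q + q') * cohn p' q' :=
    cohn_add (by linarith)
  have := (trace_cohn _ _ _ _ h).2.1
  unfold cohnEntry at *
  rw [e, cohn_add h, mul_mul_self_right (det_cohn _ _), this]
  simp only [Matrix.sub_apply, Matrix.smul_apply, smul_eq_mul]

lemma cohnEntry_one_one : cohnEntry 1 1 = 2 := by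
  have : cohn (0 + 1) (1 + 0) = _ := cohn_add (p := 0) (q := 1) (p' := 1) (q' := 0) rfl
  rw [cohnEntry, this, cohn_zero_one, cohn_one_zero]
  simp

lemma cohnEntry_zero_one : cohnEntry 0 1 = 1 := by rw [cohnEntry, cohn_zero_one]; rfl

lemma cohnEntry_one_zero : cohnEntry 1 0 = 1 := by rw [cohnEntry, cohn_one_zero]; rfl

/-- Each Farey step replaces one entry by the other root of Markoff's equation as a quadratic in
that entry. -/
lemma cohnEntry_markoff : ∀ p q p' q', q * p' = p * q' + 1 →
    cohnEntry p q ^ 2 + cohnEntry p' q' ^ 2 + cohnEntry (p + p') (q + q') ^ 2 =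
      3 * cohnEntry p q * cohnEntry p' q' * cohnEntry (p + p') (q + q') := by
  apply farey_induction
  · simp [cohnEntry_one_one, cohnEntry_zero_one, cohnEntry_one_zero]
  · intro p q p' q' h ih
    rw [cohnEntry_add_left h]
    linear_combination ih
  · intro p q p' q' h ih
    rw [cohnEntry_add_right h]
    linear_combination ih

/-! ### Counting matchings row by row -/

/-- The systems of distinct representatives of the first `N` rows of a relation that use exactly
the elements of `B`. -/
def matchingSet {β : Type*} (R : ℕ → β → Prop) (N : ℕ) (B : Finset β) : Set (Fin N → β) :=
  {f | Function.Injective f ∧ Set.range f = B ∧ ∀ i : Fin N, R i (f i)}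

/-- The number of perfect matchings of the first `N` rows of a relation with `B`. -/
noncomputable def matchingCount {β : Type*} (R : ℕ → β → Prop) (N : ℕ) (B : Finset β) : ℕ :=
  Nat.card (matchingSet R N B)

lemma finite_matchingSet {β : Type*} (R : ℕ → β → Prop) (N : ℕ) (B : Finset β) :
    (matchingSet R N B).Finite := by
  refine (Set.Finite.pi' (t := fun _ : Fin N => (B : Set β)) fun _ => B.finite_toSet).subset ?_
  intro f hf i
  rw [← hf.2.1]
  exact Set.mem_range_self i

lemma matchingCount_zero {β : Type*} (R : ℕ → β → Prop) : matchingCount R 0 (∅ : Finset β) = 1 := by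
  have : matchingSet R 0 (∅ : Finset β) = Set.univ := by
    ext f
    simp [matchingSet, Function.injective_of_subsingleton]
  rw [matchingCount, this]
  simp

lemma matchingCount_eq_zero {β : Type*} {R : ℕ → β → Prop} {N : ℕ} {B : Finset β} {b : β}
    (hb : b ∈ B) (h : ∀ i < N, ¬ R i b) : matchingCount R N B = 0 := by
  have : matchingSet R N B = ∅ := by
    ext f
    simp only [Set.mem_empty_iff_false, iff_false]
    intro hf
    have : b ∈ Set.range f := by rw [hf.2.1]; exact hb
    obtain ⟨i, rfl⟩ := this
    exact h i i.2 (hf.2.2 i)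
  rw [matchingCount, this]
  simp

lemma snoc_mem_matchingSet {β : Type*} [DecidableEq β] {R : ℕ → β → Prop} {N : ℕ} {B : Finset β}
    {g : Fin N → β} {b : β} :
    (Fin.snoc g b : Fin (N + 1) → β) ∈ matchingSet R (N + 1) B ↔
      (b ∈ B ∧ R N b) ∧ g ∈ matchingSet R N (B.erase b) := by
  simp only [matchingSet, Set.mem_ofPred_eq, Fin.snoc_injective_iff, Fin.range_snoc,
    Fin.forall_fin_succ', Fin.snoc_castSucc, Fin.snoc_last, Fin.val_castSucc, Fin.val_last]
  constructor
  · rintro ⟨⟨h1, h2⟩, h3, h4, h5⟩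
    have hb : b ∈ B := by
      rw [← Finset.mem_coe, ← h3]; exact Set.mem_insert _ _
    refine ⟨⟨hb, h5⟩, h1, ?_, h4⟩
    rw [Finset.coe_erase, ← h3, Set.insert_sdiff_self_of_notMem h2]
  · rintro ⟨⟨h1, h2⟩, h3, h4, h5⟩
    refine ⟨⟨h3, ?_⟩, ?_, h5, h2⟩
    · rw [h4]; simp
    · rw [h4, Finset.coe_erase, Set.insert_sdiff_singleton, Set.insert_eq_of_mem]
      exact h1

/-- Expansion along the choice made by the last row. -/
lemma matchingCount_succ {β : Type*} [DecidableEq β] (R : ℕ → β → Prop) [∀ i, DecidablePred (R i)]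
    (N : ℕ) (B : Finset β) :
    matchingCount R (N + 1) B = ∑ b ∈ B with R N b, matchingCount R N (B.erase b) := by
  let e : matchingSet R (N + 1) B ≃
      Σ b : {b // b ∈ B.filter (R N)}, matchingSet R N (B.erase b) :=
    { toFun := fun f => by
        have h := f.2
        rw [← Fin.snoc_init_self (q := f.1)] at h
        have h' := snoc_mem_matchingSet.1 h
        exact ⟨⟨f.1 (Fin.last N), Finset.mem_filter.2 h'.1⟩, ⟨Fin.init f.1, h'.2⟩⟩
      invFun := fun x => ⟨(Fin.snoc x.2.1 x.1.1 : Fin (N + 1) → β),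
        snoc_mem_matchingSet.2 ⟨Finset.mem_filter.1 x.1.2, x.2.2⟩⟩
      left_inv := fun f => Subtype.ext (Fin.snoc_init_self (q := f.1))
      right_inv := by
        rintro ⟨⟨b, hb⟩, ⟨g, hg⟩⟩
        refine Sigma.ext (Subtype.ext ?_) ?_
        · simp
        · have : ∀ (b' : β) (g' : Fin N → β) (hg' : g' ∈ matchingSet R N (B.erase b')),
              b' = b → g' = g → HEq (⟨g', hg'⟩ : matchingSet R N (B.erase b'))
                (⟨g, hg⟩ : matchingSet R N (B.erase b)) := by
            rintro b' g' hg' rfl rfl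
            rfl
          exact this _ _ _ (by simp) (by simp) }
  have : ∀ b : {b // b ∈ B.filter (R N)}, Finite (matchingSet R N (B.erase b)) :=
    fun b => (finite_matchingSet _ _ _).to_subtype
  rw [matchingCount, Nat.card_congr e, Nat.card_sigma]
  exact Finset.sum_coe_sort (B.filter (R N)) (fun b => Nat.card (matchingSet R N (B.erase b)))

/-! ### Transfer matrices of the strip -/

/-- The incidences of the strip. Row `2k` is the lower and row `2k+1` the upper triangle on the
`k`th crossed edge, whose endpoints are `(k, false)` and `(k, true)`. -/
def snakeRel (t : ℕ → Bool) (i : ℕ) (b : ℕ × Bool) : Prop :=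
  if i % 2 = 0 then b.1 = i / 2 ∨ (b.1 + 1 = i / 2 ∧ b.2 = t b.1)
  else b.1 = i / 2 ∨ (b.1 = i / 2 + 1 ∧ b.2 = !t (i / 2))

instance (t : ℕ → Bool) (i : ℕ) : DecidablePred (snakeRel t i) := fun b => by
  unfold snakeRel; infer_instance

lemma snakeRel_even (t : ℕ → Bool) (k : ℕ) (b : ℕ × Bool) :
    snakeRel t (2 * k) b ↔ b.1 = k ∨ (b.1 + 1 = k ∧ b.2 = t b.1) := by
  simp [snakeRel]

lemma snakeRel_odd (t : ℕ → Bool) (k : ℕ) (b : ℕ × Bool) :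
    snakeRel t (2 * k + 1) b ↔ b.1 = k ∨ (b.1 = k + 1 ∧ b.2 = !t k) := by
  have h1 : (2 * k + 1) % 2 = 1 := by omega
  have h2 : (2 * k + 1) / 2 = k := by omega
  simp [snakeRel, h1, h2]

lemma lt_of_snakeRel {t : ℕ → Bool} {i m : ℕ} {b : ℕ × Bool} (h : snakeRel t i b)
    (hi : i + 1 < 2 * m) : b.1 < m := by
  unfold snakeRel at h
  split_ifs at h <;> omega

/-- The endpoints of the first `m` crossed edges. -/
def snakeBlocks (m : ℕ) : Finset (ℕ × Bool) := Finset.range m ×ˢ Finset.univ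

lemma mem_snakeBlocks {m : ℕ} {b : ℕ × Bool} : b ∈ snakeBlocks m ↔ b.1 < m := by
  simp [snakeBlocks]

/-- Matchings of the first `m` blocks together with one more endpoint and lower triangle. -/
noncomputable def halfCount (t : ℕ → Bool) (m : ℕ) (s : Bool) : ℕ :=
  matchingCount (snakeRel t) (2 * m + 1) (insert (m, !s) (snakeBlocks m))

/-- The last upper triangle takes one of the two endpoints of its own edge; its third vertex is not
available. -/
lemma matchingCount_blocks_succ (t : ℕ → Bool) (m : ℕ) :
    matchingCount (snakeRel t) (2 * (m + 1)) (snakeBlocks (m + 1)) =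
      halfCount t m false + halfCount t m true := by
  have e : (snakeBlocks (m + 1)).filter (snakeRel t (2 * m + 1)) = {(m, false), (m, true)} := by
    ext ⟨j, s⟩
    simp only [Finset.mem_filter, mem_snakeBlocks, snakeRel_odd, Finset.mem_insert,
      Finset.mem_singleton, Prod.mk.injEq]
    cases s <;> simp <;> omega
  have e' : ∀ s, (snakeBlocks (m + 1)).erase (m, s) = insert (m, !s) (snakeBlocks m) := by
    intro s
    ext ⟨j, s'⟩
    simp only [Finset.mem_erase, mem_snakeBlocks, Finset.mem_insert, Prod.mk.injEq, ne_eq]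
    cases s <;> cases s' <;> simp <;> omega
  rw [show 2 * (m + 1) = 2 * m + 1 + 1 by ring, matchingCount_succ, e,
    Finset.sum_pair (by simp), e', e']
  rfl

lemma halfCount_zero (t : ℕ → Bool) (s : Bool) : halfCount t 0 s = 1 := by
  have e : (insert (0, !s) (snakeBlocks 0)).filter (snakeRel t 0) = {(0, !s)} := by
    ext ⟨j, s'⟩
    have := snakeRel_even t 0 (j, s')
    simp only [mul_zero] at this
    simp only [Finset.mem_filter, mem_snakeBlocks, this, Finset.mem_insert,
      Finset.mem_singleton, Prod.mk.injEq]
    simp +contextual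
  rw [halfCount, mul_zero, matchingCount_succ, e, Finset.sum_singleton]
  convert matchingCount_zero (snakeRel t)
  simp [snakeBlocks]

/-- The last lower triangle takes either the new endpoint, leaving complete blocks, or its corner
`(m, t m)`. In the second case the new endpoint falls to the preceding upper triangle, which is
incident to it only if `s = t m`. -/
lemma halfCount_succ (t : ℕ → Bool) (m : ℕ) (s : Bool) :
    halfCount t (m + 1) s =
      matchingCount (snakeRel t) (2 * (m + 1)) (snakeBlocks (m + 1)) +
        if s = t m then halfCount t m s else 0 := by
  have e : (insert (m + 1, !s) (snakeBlocks (m + 1))).filter (snakeRel t (2 * (m + 1))) =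
      {(m + 1, !s), (m, t m)} := by
    ext ⟨j, s'⟩
    simp only [Finset.mem_filter, mem_snakeBlocks, snakeRel_even, Finset.mem_insert,
      Finset.mem_singleton, Prod.mk.injEq]
    constructor
    · rintro ⟨h1, h2 | ⟨h2, h3⟩⟩
      · exact Or.inl (h1.resolve_right (by omega))
      · obtain rfl : j = m := by omega
        exact Or.inr ⟨rfl, h3⟩
    · rintro (⟨rfl, rfl⟩ | ⟨rfl, rfl⟩) <;> simp
  have e1 : (insert (m + 1, !s) (snakeBlocks (m + 1))).erase (m + 1, !s) = snakeBlocks (m + 1) :=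
    Finset.erase_insert (by simp [mem_snakeBlocks])
  rw [halfCount, matchingCount_succ, e, Finset.sum_pair (by simp), e1]
  congr 1
  rw [show 2 * (m + 1) = 2 * m + 1 + 1 by ring, matchingCount_succ]
  have e2 : ((insert (m + 1, !s) (snakeBlocks (m + 1))).erase (m, t m)).filter
      (snakeRel t (2 * m + 1)) =
      if s = t m then {(m, !t m), (m + 1, !t m)} else {(m, !t m)} := by
    ext ⟨j, s'⟩
    simp only [Finset.mem_filter, mem_snakeBlocks, snakeRel_odd, Finset.mem_insert,
      Finset.mem_erase, Prod.mk.injEq, ne_eq]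
    split_ifs with hs
    · subst hs
      simp only [Finset.mem_insert, Finset.mem_singleton, Prod.mk.injEq]
      cases s' <;> cases t m <;> simp <;> omega
    · simp only [Finset.mem_singleton, Prod.mk.injEq]
      revert hs
      cases s' <;> cases t m <;> cases s <;> simp <;> omega
  -- If that upper triangle takes `(m, !t m)` instead, no earlier row can cover the new endpoint.
  have e3 : matchingCount (snakeRel t) (2 * m + 1)
      (((insert (m + 1, !s) (snakeBlocks (m + 1))).erase (m, t m)).erase (m, !t m)) = 0 := by
    apply matchingCount_eq_zero (b := (m + 1, !s))
    · simp
    · intro i hi h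
      have := lt_of_snakeRel (m := m + 1) h (by omega)
      simp at this
  rw [e2]
  split_ifs with hs
  · rw [Finset.sum_pair (by simp), e3, zero_add, halfCount]
    congr 1
    subst hs
    ext ⟨j, s'⟩
    simp only [mem_snakeBlocks, Finset.mem_insert, Finset.mem_erase, Prod.mk.injEq, ne_eq]
    cases s' <;> cases t m <;> simp <;> omega
  · rw [Finset.sum_singleton, e3]

/-- The two counts form the row vector `(1, 1)` times the word matrix. -/
lemma halfCount_eq (t : ℕ → Bool) (m : ℕ) :
    (halfCount t m false : ℤ) = wordMatrix t m 0 0 + wordMatrix t m 1 0 ∧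
    (halfCount t m true : ℤ) = wordMatrix t m 0 1 + wordMatrix t m 1 1 := by
  induction m with
  | zero => simp [halfCount_zero, wordMatrix]
  | succ m ih =>
    rw [halfCount_succ, halfCount_succ, matchingCount_blocks_succ, wordMatrix]
    simp only [Matrix.mul_apply, Fin.sum_univ_two]
    push_cast
    rw [ih.1, ih.2]
    cases t m <;> simp [stepMatrix] <;> constructor <;> ring

lemma wordMatrix_succ' (t : ℕ → Bool) (k : ℕ) :
    wordMatrix t (k + 1) = stepMatrix (t 0) * wordMatrix (fun j => t (j + 1)) k := by
  induction k with
  | zero => simp [wordMatrix]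
  | succ k ih => rw [wordMatrix, ih, wordMatrix, mul_assoc]

lemma matchingCount_eq_cohnEntry {p q : ℕ} (hp : 0 < p) (hq : 0 < q) :
    (matchingCount (snakeRel fun j => christoffelStep p (p + q) (j + 1)) (2 * (p + q - 1))
      (snakeBlocks (p + q - 1)) : ℤ) = cohnEntry p q := by
  obtain ⟨m, hm⟩ : ∃ m, p + q = m + 2 := ⟨p + q - 2, by omega⟩
  have h0 : christoffelStep p (m + 2) 0 = false := by
    have : p / (m + 2) = 0 := Nat.div_eq_of_lt (by omega)
    simp [christoffelStep, this]
  have h1 : christoffelStep p (m + 2) (m + 1) = true := by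
    simp only [christoffelStep, decide_eq_true_eq]
    rw [show m + 1 + 1 = m + 2 by ring, Nat.mul_div_cancel_left _ (by omega),
      Nat.div_lt_iff_lt_mul (by omega), mul_comm]
    exact Nat.mul_lt_mul_of_pos_left (by omega) hp
  -- The lower row of the matrix of `false` and the left column of the matrix of `true` are both
  -- `(1, 1)`. Hence the outer letters turn the lower left entry into the sum of all entries of the
  -- inner product.
  rw [cohnEntry, cohn, hm, show m + 2 - 1 = m + 1 by omega, matchingCount_blocks_succ,
    wordMatrix, wordMatrix_succ', h0, h1]
  push_cast
  rw [(halfCount_eq _ m).1, (halfCount_eq _ m).2]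
  simp only [stepMatrix, Matrix.mul_apply, Fin.sum_univ_two]
  simp

/-! ### Perfect matchings as incident bijections -/

section PerfectMatchings

variable {B : Set TriLattice} {T : Set (Finset TriLattice)}

lemma incidenceGraph_adj_inr_inl {t : T} {p : B} :
    (incidenceGraph B T).Adj (Sum.inr t) (Sum.inl p) ↔ (p : TriLattice) ∈ (t : Finset TriLattice) := by
  rw [incidenceGraph, SimpleGraph.fromRel_adj]
  constructor
  · rintro ⟨-, ⟨p', t', h1, -, -⟩ | ⟨p', t', h1, h2, h⟩⟩
    · cases h1
    · rwa [Sum.inl.inj h1, Sum.inr.inj h2]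
  · exact fun h => ⟨Sum.inr_ne_inl, Or.inr ⟨p, t, rfl, rfl, h⟩⟩

lemma incidenceGraph_not_adj_inl {p p' : B} :
    ¬ (incidenceGraph B T).Adj (Sum.inl p) (Sum.inl p') := by
  simp [incidenceGraph]

lemma incidenceGraph_not_adj_inr {t t' : T} :
    ¬ (incidenceGraph B T).Adj (Sum.inr t) (Sum.inr t') := by
  simp [incidenceGraph]

/-- The subgraph of the pairs of a bijection from white to black vertices. -/
def matchingOfEquiv (e : T ≃ B) (h : ∀ t : T, (e t : TriLattice) ∈ (t : Finset TriLattice)) :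
    (incidenceGraph B T).Subgraph where
  verts := Set.univ
  Adj x y := (∃ t, x = Sum.inr t ∧ y = Sum.inl (e t)) ∨ ∃ t, y = Sum.inr t ∧ x = Sum.inl (e t)
  adj_sub := by
    rintro x y (⟨t, rfl, rfl⟩ | ⟨t, rfl, rfl⟩)
    · exact incidenceGraph_adj_inr_inl.2 (h t)
    · exact (incidenceGraph_adj_inr_inl.2 (h t)).symm
  edge_vert _ := Set.mem_univ _
  symm := ⟨fun _ _ h => h.symm⟩

lemma matchingOfEquiv_isPerfectMatching (e : T ≃ B)
    (h : ∀ t : T, (e t : TriLattice) ∈ (t : Finset TriLattice)) :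
    (matchingOfEquiv e h).IsPerfectMatching := by
  rw [SimpleGraph.Subgraph.isPerfectMatching_iff]
  rintro (b | t)
  · refine ⟨Sum.inr (e.symm b), Or.inr ⟨e.symm b, rfl, by simp⟩, ?_⟩
    rintro y (⟨t, h1, h2⟩ | ⟨t, h1, h2⟩)
    · simp at h1
    · rw [h1, Sum.inl.inj h2]; simp
  · refine ⟨Sum.inl (e t), Or.inl ⟨t, rfl, rfl⟩, ?_⟩
    rintro y (⟨t', h1, h2⟩ | ⟨t', h1, h2⟩)
    · rw [h2, Sum.inr.inj h1]
    · simp at h2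

/-- Edges join only triangles to points, so the partner maps in the two directions are mutually
inverse. -/
lemma exists_matchingOfEquiv {H : (incidenceGraph B T).Subgraph} (hH : H.IsPerfectMatching) :
    ∃ (e : T ≃ B) (h : ∀ t : T, (e t : TriLattice) ∈ (t : Finset TriLattice)),
      matchingOfEquiv e h = H := by
  have hH' := SimpleGraph.Subgraph.isPerfectMatching_iff.1 hH
  have h1 : ∀ t : T, ∃ b : B, H.Adj (Sum.inr t) (Sum.inl b) := by
    intro t
    obtain ⟨b | t', h, -⟩ := hH' (Sum.inr t)
    · exact ⟨b, h⟩
    · exact (incidenceGraph_not_adj_inr h.adj_sub).elim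
  have h2 : ∀ b : B, ∃ t : T, H.Adj (Sum.inr t) (Sum.inl b) := by
    intro b
    obtain ⟨b' | t, h, -⟩ := hH' (Sum.inl b)
    · exact (incidenceGraph_not_adj_inl h.adj_sub).elim
    · exact ⟨t, h.symm⟩
  choose f hf using h1
  choose g hg using h2
  have hfu : ∀ t b, H.Adj (Sum.inr t) (Sum.inl b) → b = f t := fun t b h =>
    Sum.inl.inj ((hH' (Sum.inr t)).unique h (hf t))
  have hgu : ∀ t b, H.Adj (Sum.inr t) (Sum.inl b) → t = g b := fun t b h =>
    Sum.inr.inj ((hH' (Sum.inl b)).unique h.symm (hg b).symm)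
  let e : T ≃ B := ⟨f, g, fun t => (hgu _ _ (hf t)).symm, fun b => (hfu _ _ (hg b)).symm⟩
  refine ⟨e, fun t => incidenceGraph_adj_inr_inl.1 (hf t).adj_sub, ?_⟩
  apply SimpleGraph.Subgraph.ext
  · exact (SimpleGraph.Subgraph.isSpanning_iff.1 hH.2).symm
  · ext x y
    constructor
    · rintro (⟨t, rfl, rfl⟩ | ⟨t, rfl, rfl⟩)
      · exact hf t
      · exact (hf t).symm
    · intro h
      rcases x with b | t <;> rcases y with b' | t'
      · exact (incidenceGraph_not_adj_inl h.adj_sub).elim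
      · refine Or.inr ⟨t', rfl, ?_⟩
        rw [hfu t' b h.symm]; rfl
      · refine Or.inl ⟨t, rfl, ?_⟩
        rw [hfu t b' h]; rfl
      · exact (incidenceGraph_not_adj_inr h.adj_sub).elim

/-- Perfect matchings of an incidence graph are the incident bijections. -/
lemma ncard_isPerfectMatching (B : Set TriLattice) (T : Set (Finset TriLattice)) :
    {H : (incidenceGraph B T).Subgraph | H.IsPerfectMatching}.ncard =
      Nat.card {e : T ≃ B // ∀ t : T, (e t : TriLattice) ∈ (t : Finset TriLattice)} := by
  rw [← Nat.card_coe_set_eq]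
  symm
  refine Nat.card_congr (Equiv.ofBijective
    (fun e => ⟨matchingOfEquiv e.1 e.2, matchingOfEquiv_isPerfectMatching e.1 e.2⟩) ⟨?_, ?_⟩)
  · rintro ⟨e, he⟩ ⟨e', he'⟩ h
    apply Subtype.ext
    ext1 t
    have h1 : matchingOfEquiv e he = matchingOfEquiv e' he' := congrArg Subtype.val h
    have h2 : (matchingOfEquiv e' he').Adj (Sum.inr t) (Sum.inl (e t)) := by
      rw [← h1]; exact Or.inl ⟨t, rfl, rfl⟩
    rcases h2 with ⟨t', h3, h4⟩ | ⟨t', h3, h4⟩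
    · rw [Sum.inl.inj h4, Sum.inr.inj h3]
    · simp at h3
  · rintro ⟨H, hH⟩
    obtain ⟨e, h, rfl⟩ := exists_matchingOfEquiv hH
    exact ⟨⟨e, h⟩, rfl⟩

end PerfectMatchings

lemma card_equiv_congr {T B T' B' : Type*} (φ : T ≃ T') (ψ : B ≃ B') {R : T → B → Prop}
    {R' : T' → B' → Prop} (h : ∀ t b, R t b ↔ R' (φ t) (ψ b)) :
    Nat.card {e : T ≃ B // ∀ t, R t (e t)} = Nat.card {e : T' ≃ B' // ∀ t, R' t (e t)} := by
  refine Nat.card_congr ((Equiv.equivCongr φ ψ).subtypeEquiv fun e => ?_)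
  rw [← φ.forall_congr_right]
  simp [h]

lemma card_equiv_eq_matchingCount {β : Type*} (R : ℕ → β → Prop) (N : ℕ) (B : Finset β) :
    Nat.card {e : Fin N ≃ B // ∀ i : Fin N, R i (e i)} = matchingCount R N B := by
  refine Nat.card_congr (Equiv.ofBijective
    (fun e => ⟨fun i => (e.1 i : β), ?_, ?_, e.2⟩) ⟨?_, ?_⟩)
  · exact Subtype.val_injective.comp e.1.injective
  · ext b
    constructor
    · rintro ⟨i, rfl⟩
      exact (e.1 i).2
    · intro hb
      exact ⟨e.1.symm ⟨b, hb⟩, by simp⟩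
  · rintro ⟨e, he⟩ ⟨e', he'⟩ h
    apply Subtype.ext
    ext i
    exact congrFun (congrArg Subtype.val h) i
  · rintro ⟨f, h1, h2, h3⟩
    have h4 : ∀ i, f i ∈ B := fun i => by
      rw [← Finset.mem_coe, ← h2]; exact Set.mem_range_self i
    refine ⟨⟨Equiv.ofBijective (fun i => ⟨f i, h4 i⟩) ⟨?_, ?_⟩, h3⟩, rfl⟩
    · intro i j hij
      exact h1 (congrArg Subtype.val hij)
    · rintro ⟨b, hb⟩
      rw [← Finset.mem_coe, ← h2] at hb
      obtain ⟨i, rfl⟩ := hb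
      exact ⟨i, rfl⟩

/-! ### Coordinates and the lattice triangles -/

/-- The lattice point with the given first two coordinates. -/
def pt (x y : ℤ) : TriLattice :=
  ⟨![x, y, -x - y], by
    change (![x, y, -x - y] : Fin 3 → ℤ) 0 + ![x, y, -x - y] 1 + ![x, y, -x - y] 2 = 0
    simp⟩

@[simp] lemma pt_val (x y : ℤ) : (pt x y : Fin 3 → ℤ) = ![x, y, -x - y] := rfl

lemma sum_eq_zero (p : TriLattice) :
    (p : Fin 3 → ℤ) 0 + (p : Fin 3 → ℤ) 1 + (p : Fin 3 → ℤ) 2 = 0 := p.2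

lemma eq_pt (p : TriLattice) : p = pt ((p : Fin 3 → ℤ) 0) ((p : Fin 3 → ℤ) 1) := by
  apply Subtype.ext
  ext i
  have := sum_eq_zero p
  fin_cases i
  · rfl
  · rfl
  · change (p : Fin 3 → ℤ) 2 = -(p : Fin 3 → ℤ) 0 - (p : Fin 3 → ℤ) 1
    linarith

lemma exists_eq_pt (p : TriLattice) : ∃ x y, p = pt x y := ⟨_, _, eq_pt p⟩

lemma pt_inj {x y x' y' : ℤ} : pt x y = pt x' y' ↔ x = x' ∧ y = y' := by
  constructor
  · intro h
    have h' : (![x, y, -x - y] : Fin 3 → ℤ) = ![x', y', -x' - y'] := congrArg Subtype.val h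
    exact ⟨congrFun h' 0, congrFun h' 1⟩
  · rintro ⟨rfl, rfl⟩; rfl

lemma zero_eq_pt : (0 : TriLattice) = pt 0 0 := by
  apply Subtype.ext
  ext i
  fin_cases i <;> rfl

lemma pt_add (x y x' y' : ℤ) : pt x y + pt x' y' = pt (x + x') (y + y') := by
  apply Subtype.ext
  ext i
  fin_cases i <;> simp
  ring

lemma pt_sub (x y x' y' : ℤ) : pt x y - pt x' y' = pt (x - x') (y - y') := by
  apply Subtype.ext
  ext i
  fin_cases i <;> simp
  ring

lemma smul_pt (k x y : ℤ) : k • pt x y = pt (k * x) (k * y) := by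
  apply Subtype.ext
  ext i
  fin_cases i <;> simp
  ring

lemma sqLength_pt (x y : ℤ) : sqLength (pt x y) = 2 * (x ^ 2 + x * y + y ^ 2) := by
  simp [sqLength, Fin.sum_univ_three]
  ring

lemma isShortest_iff_sqLength (u : TriLattice) : IsShortest u ↔ sqLength u = 2 := by
  have key : ∀ v : TriLattice, v ≠ 0 → 2 ≤ sqLength v := by
    intro v hv
    obtain ⟨x, y, rfl⟩ := exists_eq_pt v
    rw [sqLength_pt]
    by_contra! h
    have h0 : x ^ 2 + x * y + y ^ 2 ≤ 0 := by omega
    have hx : x = 0 := by nlinarith [sq_nonneg (x + 2 * y), sq_nonneg x]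
    have hy : y = 0 := by nlinarith [sq_nonneg (y + 2 * x), sq_nonneg y]
    exact hv (by rw [zero_eq_pt, hx, hy])
  constructor
  · rintro ⟨h1, h2⟩
    have h3 := h2 (pt 1 0) (by rw [zero_eq_pt, Ne, pt_inj]; simp)
    rw [sqLength_pt] at h3
    have h4 := key u h1
    omega
  · intro h
    refine ⟨?_, fun v hv => h ▸ key v hv⟩
    rintro rfl
    rw [zero_eq_pt, sqLength_pt] at h
    omega

lemma isShortest_pt {x y : ℤ} : IsShortest (pt x y) ↔
    (x = 1 ∧ y = 0) ∨ (x = 0 ∧ y = 1) ∨ (x = -1 ∧ y = 1) ∨ (x = -1 ∧ y = 0) ∨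
      (x = 0 ∧ y = -1) ∨ (x = 1 ∧ y = -1) := by
  rw [isShortest_iff_sqLength, sqLength_pt]
  constructor
  · intro h
    have h1 : -1 ≤ x := by nlinarith [sq_nonneg (x + 2 * y)]
    have h2 : x ≤ 1 := by nlinarith [sq_nonneg (x + 2 * y)]
    have h3 : -1 ≤ y := by nlinarith [sq_nonneg (y + 2 * x)]
    have h4 : y ≤ 1 := by nlinarith [sq_nonneg (y + 2 * x)]
    interval_cases x <;> interval_cases y <;> simp_all
  · rintro (⟨rfl, rfl⟩ | ⟨rfl, rfl⟩ | ⟨rfl, rfl⟩ | ⟨rfl, rfl⟩ | ⟨rfl, rfl⟩ | ⟨rfl, rfl⟩) <;> rfl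

/-- The lattice triangle with its right-angled corner (in coordinates) at the lower left. -/
def upTriangle (i j : ℤ) : Finset TriLattice := {pt i j, pt (i + 1) j, pt i (j + 1)}

/-- The lattice triangle with its right-angled corner (in coordinates) at the upper right. -/
def downTriangle (i j : ℤ) : Finset TriLattice := {pt i j, pt (i - 1) j, pt i (j - 1)}

lemma pt_mem_upTriangle {x y i j : ℤ} : pt x y ∈ upTriangle i j ↔
    (x = i ∧ y = j) ∨ (x = i + 1 ∧ y = j) ∨ (x = i ∧ y = j + 1) := by
  simp [upTriangle, pt_inj]

lemma pt_mem_downTriangle {x y i j : ℤ} : pt x y ∈ downTriangle i j ↔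
    (x = i ∧ y = j) ∨ (x = i - 1 ∧ y = j) ∨ (x = i ∧ y = j - 1) := by
  simp [downTriangle, pt_inj]

lemma isLatticeTriangle_up (i j : ℤ) : IsLatticeTriangle (upTriangle i j) := by
  constructor
  · rw [upTriangle, Finset.card_eq_three]
    exact ⟨_, _, _, by rw [Ne, pt_inj]; omega, by rw [Ne, pt_inj]; omega, by rw [Ne, pt_inj]; omega,
      rfl⟩
  · intro a ha b hb hab
    obtain ⟨x, y, rfl⟩ := exists_eq_pt a
    obtain ⟨x', y', rfl⟩ := exists_eq_pt b
    rw [pt_mem_upTriangle] at ha hb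
    rw [Ne, pt_inj] at hab
    rw [pt_sub, isShortest_pt]
    omega

lemma isLatticeTriangle_down (i j : ℤ) : IsLatticeTriangle (downTriangle i j) := by
  constructor
  · rw [downTriangle, Finset.card_eq_three]
    exact ⟨_, _, _, by rw [Ne, pt_inj]; omega, by rw [Ne, pt_inj]; omega, by rw [Ne, pt_inj]; omega,
      rfl⟩
  · intro a ha b hb hab
    obtain ⟨x, y, rfl⟩ := exists_eq_pt a
    obtain ⟨x', y', rfl⟩ := exists_eq_pt b
    rw [pt_mem_downTriangle] at ha hb
    rw [Ne, pt_inj] at hab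
    rw [pt_sub, isShortest_pt]
    omega

lemma IsLatticeTriangle.eq_of_subset {t t' : Finset TriLattice} (ht : IsLatticeTriangle t)
    (ht' : IsLatticeTriangle t') (h : t ⊆ t') : t = t' :=
  Finset.eq_of_subset_of_card_le h (by rw [ht.1, ht'.1])

lemma IsLatticeTriangle.exists_eq {t : Finset TriLattice} (ht : IsLatticeTriangle t) :
    ∃ i j, t = upTriangle i j ∨ t = downTriangle i j := by
  obtain ⟨a, b, c, hab, hac, hbc, rfl⟩ := Finset.card_eq_three.1 ht.1
  have h1 := ht.2 b (by simp) a (by simp) hab.symm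
  have h2 := ht.2 c (by simp) a (by simp) hac.symm
  have h3 := ht.2 c (by simp) b (by simp) hbc.symm
  obtain ⟨x, y, rfl⟩ := exists_eq_pt a
  obtain ⟨x', y', rfl⟩ := exists_eq_pt b
  obtain ⟨x'', y'', rfl⟩ := exists_eq_pt c
  rw [pt_sub, isShortest_pt] at h1 h2 h3
  have up : ∀ i j, (pt x y ∈ upTriangle i j ∧ pt x' y' ∈ upTriangle i j ∧
      pt x'' y'' ∈ upTriangle i j) →
      ∃ i j, ({pt x y, pt x' y', pt x'' y''} : Finset TriLattice) = upTriangle i j ∨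
        ({pt x y, pt x' y', pt x'' y''} : Finset TriLattice) = downTriangle i j := by
    rintro i j ⟨m1, m2, m3⟩
    refine ⟨i, j, Or.inl (ht.eq_of_subset (isLatticeTriangle_up i j) ?_)⟩
    simp [Finset.insert_subset_iff, m1, m2, m3]
  have down : ∀ i j, (pt x y ∈ downTriangle i j ∧ pt x' y' ∈ downTriangle i j ∧
      pt x'' y'' ∈ downTriangle i j) →
      ∃ i j, ({pt x y, pt x' y', pt x'' y''} : Finset TriLattice) = upTriangle i j ∨
        ({pt x y, pt x' y', pt x'' y''} : Finset TriLattice) = downTriangle i j := by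
    rintro i j ⟨m1, m2, m3⟩
    refine ⟨i, j, Or.inr (ht.eq_of_subset (isLatticeTriangle_down i j) ?_)⟩
    simp [Finset.insert_subset_iff, m1, m2, m3]
  simp only [pt_mem_upTriangle] at up
  simp only [pt_mem_downTriangle] at down
  -- In each coordinate two vertices agree and the third differs by one: it is larger in both
  -- coordinates' columns for an upward triangle and smaller in both for a downward one.
  have key : x' + x'' + x = 3 * min x (min x' x'') + 1 ∧
      y' + y'' + y = 3 * min y (min y' y'') + 1 ∨
      x' + x'' + x = 3 * max x (max x' x'') - 1 ∧
      y' + y'' + y = 3 * max y (max y' y'') - 1 := by omega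
  rcases key with key | key
  · exact up (min x (min x' x'')) (min y (min y' y'')) (by omega)
  · exact down (max x (max x' x'')) (max y (max y' y'')) (by omega)

/-! ### The triangles met by the segment -/

lemma mem_openTriangle {a b c : TriLattice} (hab : a ≠ b) (hac : a ≠ c) (hbc : b ≠ c)
    {x : Fin 3 → ℝ} : x ∈ openTriangle {a, b, c} ↔ ∃ r s t : ℝ, 0 < r ∧ 0 < s ∧ 0 < t ∧
      r + s + t = 1 ∧ x = r • toReal a + s • toReal b + t • toReal c := by
  constructor
  · rintro ⟨f, h1, h2, h3⟩
    rw [Finset.sum_insert (by simp [hab, hac]), Finset.sum_pair hbc, ← add_assoc] at h2 h3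
    exact ⟨f a, f b, f c, h1 _ (by simp), h1 _ (by simp), h1 _ (by simp), h2, h3⟩
  · rintro ⟨r, s, t, hr, hs, ht, h1, h2⟩
    classical
    refine ⟨fun p => if p = a then r else if p = b then s else t, ?_, ?_, ?_⟩
    · intro p _
      dsimp only
      split_ifs <;> assumption
    · rw [Finset.sum_insert (by simp [hab, hac]), Finset.sum_pair hbc, ← add_assoc]
      simpa [hab.symm, hac.symm, hbc.symm] using h1
    · rw [Finset.sum_insert (by simp [hab, hac]), Finset.sum_pair hbc, ← add_assoc]
      simpa [hab.symm, hac.symm, hbc.symm] using h2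

lemma smul_toReal_mem_up {s : ℝ} {p q i j : ℤ} :
    s • toReal (pt p q) ∈ openTriangle (upTriangle i j) ↔
      i < s * p ∧ j < s * q ∧ s * (p + q) < i + j + 1 := by
  rw [upTriangle, mem_openTriangle (by rw [Ne, pt_inj]; omega) (by rw [Ne, pt_inj]; omega)
    (by rw [Ne, pt_inj]; omega)]
  constructor
  · rintro ⟨a, b, c, ha, hb, hc, h1, h2⟩
    have e0 := congrFun h2 0
    have e1 := congrFun h2 1
    simp [toReal] at e0 e1
    refine ⟨?_, ?_, ?_⟩
    · linear_combination hb - e0 - i * h1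
    · linear_combination hc - e1 - j * h1
    · linear_combination ha + e0 + e1 + (1 + i + j) * h1
  · rintro ⟨h1, h2, h3⟩
    refine ⟨i + j + 1 - s * (p + q), s * p - i, s * q - j, by linarith, by linarith, by linarith,
      by ring, ?_⟩
    ext k
    fin_cases k <;> simp [toReal] <;> ring

lemma smul_toReal_mem_down {s : ℝ} {p q i j : ℤ} :
    s • toReal (pt p q) ∈ openTriangle (downTriangle i j) ↔
      s * p < i ∧ s * q < j ∧ i + j - 1 < s * (p + q) := by
  rw [downTriangle, mem_openTriangle (by rw [Ne, pt_inj]; omega) (by rw [Ne, pt_inj]; omega)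
    (by rw [Ne, pt_inj]; omega)]
  constructor
  · rintro ⟨a, b, c, ha, hb, hc, h1, h2⟩
    have e0 := congrFun h2 0
    have e1 := congrFun h2 1
    simp [toReal] at e0 e1
    refine ⟨?_, ?_, ?_⟩
    · linear_combination hb + e0 + i * h1
    · linear_combination hc + e1 + j * h1
    · linear_combination ha - e0 - e1 - (i + j - 1) * h1
  · rintro ⟨h1, h2, h3⟩
    refine ⟨s * (p + q) - (i + j - 1), i - s * p, j - s * q, by linarith, by linarith, by linarith,
      by ring, ?_⟩
    ext k
    fin_cases k <;> simp [toReal] <;> ring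

lemma segment_inter_nonempty {u : TriLattice} {S : Set (Fin 3 → ℝ)} :
    (segment ℝ 0 (toReal u) ∩ S).Nonempty ↔ ∃ s : ℝ, 0 ≤ s ∧ s ≤ 1 ∧ s • toReal u ∈ S := by
  rw [segment_eq_image]
  constructor
  · rintro ⟨_, ⟨s, hs, rfl⟩, h⟩
    exact ⟨s, hs.1, hs.2, by simpa using h⟩
  · rintro ⟨s, h1, h2, h⟩
    exact ⟨_, ⟨s, ⟨h1, h2⟩, rfl⟩, by simpa using h⟩

/-- Eliminating `s` leaves the condition that the segment cross the open edge on the line `x + y = i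
+ j + 1`, which it reaches at `s = (i + j + 1) / (p + q)`. -/
lemma exists_param_up {p q i j : ℤ} (hp : 0 < p) (hq : 0 < q) :
    (∃ s : ℝ, 0 ≤ s ∧ s ≤ 1 ∧ i < s * p ∧ j < s * q ∧ s * (p + q) < i + j + 1) ↔
      0 < i + j + 1 ∧ i + j + 1 < p + q ∧ i * (p + q) < (i + j + 1) * p ∧
        j * (p + q) < (i + j + 1) * q := by
  have hp' : (0 : ℝ) < p := by exact_mod_cast hp
  have hq' : (0 : ℝ) < q := by exact_mod_cast hq
  constructor
  · rintro ⟨s, h0, h1, h2, h3, h4⟩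
    have h5 : (i : ℝ) < p := by nlinarith
    have h6 : (j : ℝ) < q := by nlinarith
    norm_cast at h5 h6
    refine ⟨?_, by omega, ?_, ?_⟩
    · have : (0 : ℝ) < i + j + 1 := lt_of_le_of_lt (by positivity) h4
      exact_mod_cast this
    · have : (i : ℝ) * (p + q) < (i + j + 1) * p := by nlinarith
      exact_mod_cast this
    · have : (j : ℝ) * (p + q) < (i + j + 1) * q := by nlinarith
      exact_mod_cast this
  · rintro ⟨h1, h2, h3, h4⟩
    have h1' : (0 : ℝ) < i + j + 1 := by exact_mod_cast h1
    have h2' : (i + j + 1 : ℝ) < p + q := by exact_mod_cast h2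
    have h3' : (i : ℝ) * (p + q) < (i + j + 1) * p := by exact_mod_cast h3
    have h4' : (j : ℝ) * (p + q) < (i + j + 1) * q := by exact_mod_cast h4
    have hn : (0 : ℝ) < p + q := by positivity
    -- A parameter just before that crossing lies in the open triangle.
    obtain ⟨s, hs1, hs2⟩ := exists_between (show
      max (i / p : ℝ) (max (j / q) 0) < (i + j + 1) / (p + q) by
        refine max_lt ?_ (max_lt ?_ (by positivity))
        · rwa [div_lt_div_iff₀ hp' hn]
        · rwa [div_lt_div_iff₀ hq' hn])
    rw [max_lt_iff, max_lt_iff, div_lt_iff₀ hp', div_lt_iff₀ hq'] at hs1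
    have hs3 : s < 1 := hs2.trans ((div_lt_one hn).2 h2')
    rw [lt_div_iff₀ hn] at hs2
    exact ⟨s, hs1.2.2.le, hs3.le, hs1.1, hs1.2.1, hs2⟩

lemma exists_param_down {p q i j : ℤ} (hp : 0 < p) (hq : 0 < q) :
    (∃ s : ℝ, 0 ≤ s ∧ s ≤ 1 ∧ s * p < i ∧ s * q < j ∧ i + j - 1 < s * (p + q)) ↔
      0 < i + j - 1 ∧ i + j - 1 < p + q ∧ (i + j - 1) * p < i * (p + q) ∧
        (i + j - 1) * q < j * (p + q) := by
  have hp' : (0 : ℝ) < p := by exact_mod_cast hp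
  have hq' : (0 : ℝ) < q := by exact_mod_cast hq
  constructor
  · rintro ⟨s, h0, h1, h2, h3, h4⟩
    have h5 : (0 : ℝ) < i := lt_of_le_of_lt (by positivity) h2
    have h6 : (0 : ℝ) < j := lt_of_le_of_lt (by positivity) h3
    norm_cast at h5 h6
    refine ⟨by omega, ?_, ?_, ?_⟩
    · have : (i + j - 1 : ℝ) < p + q := by nlinarith
      exact_mod_cast this
    · have : (i + j - 1 : ℝ) * p < i * (p + q) := by nlinarith
      exact_mod_cast this
    · have : (i + j - 1 : ℝ) * q < j * (p + q) := by nlinarith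
      exact_mod_cast this
  · rintro ⟨h1, h2, h3, h4⟩
    have h1' : (0 : ℝ) < i + j - 1 := by exact_mod_cast h1
    have h2' : (i + j - 1 : ℝ) < p + q := by exact_mod_cast h2
    have h3' : (i + j - 1 : ℝ) * p < i * (p + q) := by exact_mod_cast h3
    have h4' : (i + j - 1 : ℝ) * q < j * (p + q) := by exact_mod_cast h4
    have hn : (0 : ℝ) < p + q := by positivity
    obtain ⟨s, hs1, hs2⟩ := exists_between (show
      (i + j - 1 : ℝ) / (p + q) < min (i / p : ℝ) (min (j / q) 1) by
        refine lt_min ?_ (lt_min ?_ ((div_lt_one hn).2 h2'))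
        · rwa [div_lt_div_iff₀ hn hp']
        · rwa [div_lt_div_iff₀ hn hq'])
    rw [lt_min_iff, lt_min_iff, lt_div_iff₀ hp', lt_div_iff₀ hq'] at hs2
    have hs3 : 0 < s := lt_trans (by positivity) hs1
    rw [div_lt_iff₀ hn] at hs1
    exact ⟨s, hs3.le, hs2.2.2.le, hs2.1, hs2.2.1, hs1⟩

lemma up_mem_stripTriangles {p q i j : ℤ} (hp : 0 < p) (hq : 0 < q) :
    upTriangle i j ∈ stripTriangles (pt p q) ↔ 0 < i + j + 1 ∧ i + j + 1 < p + q ∧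
      i * (p + q) < (i + j + 1) * p ∧ j * (p + q) < (i + j + 1) * q := by
  rw [← exists_param_up hp hq]
  simp only [stripTriangles, Set.mem_ofPred_eq, isLatticeTriangle_up, true_and,
    segment_inter_nonempty, smul_toReal_mem_up]

lemma down_mem_stripTriangles {p q i j : ℤ} (hp : 0 < p) (hq : 0 < q) :
    downTriangle i j ∈ stripTriangles (pt p q) ↔ 0 < i + j - 1 ∧ i + j - 1 < p + q ∧
      (i + j - 1) * p < i * (p + q) ∧ (i + j - 1) * q < j * (p + q) := by
  rw [← exists_param_down hp hq]
  simp only [stripTriangles, Set.mem_ofPred_eq, isLatticeTriangle_down, true_and,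
    segment_inter_nonempty, smul_toReal_mem_down]

/-! ### The strip as a sequence of crossed edges -/

lemma crossing_succ {p n : ℕ} (hn : 0 < n) (hp : p ≤ n) (k : ℕ) :
    (k + 1) * p / n = k * p / n + (christoffelStep p n k).toNat := by
  have h1 : (k + 1) * p / n ≤ k * p / n + 1 := by
    rw [← Nat.add_div_right _ hn]
    apply Nat.div_le_div_right
    linarith [add_mul k 1 p]
  have h2 : k * p / n ≤ (k + 1) * p / n := Nat.div_le_div_right (Nat.mul_le_mul_right _ (by omega))
  by_cases h : k * p / n < (k + 1) * p / n
  · simp only [christoffelStep, h, decide_true, Bool.toNat_true]; omega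
  · simp only [christoffelStep, h, decide_false, Bool.toNat_false]; omega

/-- Coprimality keeps lattice points off the open segment, so the lower bound is strict. -/
lemma crossing_spec {p n k : ℕ} (hn : p.Coprime n) (h0 : 0 < k) (hk : k < n) :
    k * p / n * n < k * p ∧ k * p < (k * p / n + 1) * n := by
  constructor
  · refine lt_of_le_of_ne (Nat.div_mul_le_self _ _) fun h => ?_
    have h1 : n ∣ k * p := ⟨k * p / n, by rw [mul_comm n, h]⟩
    exact absurd (Nat.le_of_dvd h0 (hn.symm.dvd_of_dvd_mul_right h1)) (by omega)
  · rw [mul_comm _ n]; exact Nat.lt_mul_div_succ _ (by omega)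

/-- The endpoints of the edges crossed by the segment. -/
def snakePoint (p n : ℕ) (b : ℕ × Bool) : TriLattice :=
  pt (((b.1 + 1) * p / n : ℕ) + b.2.toNat) (b.1 + 1 - ((b.1 + 1) * p / n : ℕ) - b.2.toNat)

/-- The triangles crossed by the segment, in order. -/
def snakeTriangle (p n : ℕ) (i : ℕ) : Finset TriLattice :=
  if i % 2 = 0 then
    upTriangle ((i / 2 + 1) * p / n : ℕ) ((i / 2 : ℕ) - ((i / 2 + 1) * p / n : ℕ))
  else
    downTriangle (((i / 2 + 1) * p / n : ℕ) + 1) ((i / 2 : ℕ) + 1 - ((i / 2 + 1) * p / n : ℕ))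

lemma snakeTriangle_even (p n k : ℕ) : snakeTriangle p n (2 * k) =
    upTriangle ((k + 1) * p / n : ℕ) (k - ((k + 1) * p / n : ℕ)) := by
  simp [snakeTriangle]

lemma snakeTriangle_odd (p n k : ℕ) : snakeTriangle p n (2 * k + 1) =
    downTriangle (((k + 1) * p / n : ℕ) + 1) (k + 1 - ((k + 1) * p / n : ℕ)) := by
  have h1 : (2 * k + 1) % 2 = 1 := by omega
  have h2 : (2 * k + 1) / 2 = k := by omega
  simp [snakeTriangle, h1, h2]

lemma sum_snakeTriangle (p n i : ℕ) :
    ∑ x ∈ snakeTriangle p n i, ((x : Fin 3 → ℤ) 0 + (x : Fin 3 → ℤ) 1) =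
      if i % 2 = 0 then 3 * (i / 2 : ℕ) + 2 else 3 * (i / 2 : ℕ) + 4 := by
  unfold snakeTriangle
  split_ifs with h
  · rw [upTriangle, Finset.sum_insert, Finset.sum_pair]
    · simp; ring
    · rw [Ne, pt_inj]; omega
    · simp [pt_inj]
  · rw [downTriangle, Finset.sum_insert, Finset.sum_pair]
    · simp; ring
    · rw [Ne, pt_inj]; omega
    · simp only [Finset.mem_insert, Finset.mem_singleton, pt_inj]; omega

lemma snakeTriangle_injective (p n : ℕ) : Function.Injective (snakeTriangle p n) := by
  intro i i' h
  have h1 := sum_snakeTriangle p n i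
  -- The sum is `2` modulo `3` for even indices and `1` for odd ones, so it determines both the
  -- parity and the level.
  rw [h, sum_snakeTriangle] at h1
  split_ifs at h1 <;> omega

lemma snakePoint_injective (p n : ℕ) : Function.Injective (snakePoint p n) := by
  rintro ⟨j, s⟩ ⟨j', s'⟩ h
  simp only [snakePoint, pt_inj] at h
  obtain rfl : j = j' := by omega
  have : s.toNat = s'.toNat := by omega
  cases s <;> cases s' <;> simp_all

lemma snakeTriangle_mem {p q i : ℕ} (hp : 0 < p) (hq : 0 < q) (h : p.Coprime q)
    (hi : i < 2 * (p + q - 1)) : snakeTriangle p (p + q) i ∈ stripTriangles (pt p q) := by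
  have h' : p.Coprime (p + q) := by simpa using h
  rcases Nat.even_or_odd' i with ⟨k, rfl | rfl⟩
  · rw [snakeTriangle_even, up_mem_stripTriangles (by omega) (by omega)]
    obtain ⟨h1, h2⟩ := crossing_spec h' (k := k + 1) (by omega) (by omega)
    generalize (k + 1) * p / (p + q) = c at *
    zify at h1 h2
    refine ⟨by omega, by omega, ?_, ?_⟩ <;> nlinarith
  · rw [snakeTriangle_odd, down_mem_stripTriangles (by omega) (by omega)]
    obtain ⟨h1, h2⟩ := crossing_spec h' (k := k + 1) (by omega) (by omega)
    generalize (k + 1) * p / (p + q) = c at *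
    zify at h1 h2
    refine ⟨by omega, by omega, ?_, ?_⟩ <;> nlinarith

lemma eq_crossing {p n k : ℕ} {i : ℤ} (hn : 0 < n) (h1 : i * n < k * p) (h2 : k * p < (i + 1) * n) :
    i = (k * p / n : ℕ) := by
  push_cast
  symm
  rw [Int.ediv_eq_iff_of_pos (by omega)]
  constructor <;> linarith

lemma exists_snakeTriangle {p q : ℕ} (hp : 0 < p) (hq : 0 < q) {t : Finset TriLattice}
    (ht : t ∈ stripTriangles (pt p q)) :
    ∃ i < 2 * (p + q - 1), snakeTriangle p (p + q) i = t := by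
  obtain ⟨i, j, rfl | rfl⟩ := ht.1.exists_eq
  · rw [up_mem_stripTriangles (by omega) (by omega)] at ht
    obtain ⟨h1, h2, h3, h4⟩ := ht
    obtain ⟨k, hk⟩ := Int.eq_ofNat_of_zero_le (show 0 ≤ i + j by omega)
    refine ⟨2 * k, by omega, ?_⟩
    have : i = ((k + 1) * p / (p + q) : ℕ) := by
      apply eq_crossing (by omega)
      · push_cast; rw [← hk]; exact h3
      · push_cast; rw [← hk]; linarith
    rw [snakeTriangle_even, ← this]
    congr 1
    omega
  · rw [down_mem_stripTriangles (by omega) (by omega)] at ht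
    obtain ⟨h1, h2, h3, h4⟩ := ht
    obtain ⟨k, hk⟩ := Int.eq_ofNat_of_zero_le (show 0 ≤ i + j - 2 by omega)
    refine ⟨2 * k + 1, by omega, ?_⟩
    have hk' : (k : ℤ) + 1 = i + j - 1 := by omega
    have : i - 1 = ((k + 1) * p / (p + q) : ℕ) := by
      apply eq_crossing (by omega)
      · push_cast; rw [hk']; linarith
      · push_cast; rw [hk']; linarith
    rw [snakeTriangle_odd, ← this]
    congr 1 <;> omega

/-- The point `b` has level `b.1 + 1`, and a triangle meets only two adjacent levels. On the level
of its edge both endpoints belong to it; on the other level the Christoffel letter selects its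
corner. -/
lemma snakePoint_mem_snakeTriangle {p q i : ℕ} (hp : 0 < p) (b : ℕ × Bool) :
    snakeRel (fun j => christoffelStep p (p + q) (j + 1)) i b ↔
      snakePoint p (p + q) b ∈ snakeTriangle p (p + q) i := by
  obtain ⟨j, s⟩ := b
  rcases Nat.even_or_odd' i with ⟨k, rfl | rfl⟩
  · rw [snakeTriangle_even, snakeRel_even, snakePoint, pt_mem_upTriangle]
    dsimp only
    by_cases hj : j = k
    · subst hj
      have := s.toNat_le
      simp only [true_or, true_iff]
      omega
    · by_cases hj' : j + 1 = k
      · subst hj'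
        rw [crossing_succ (by omega) (by omega) (j + 1)]
        cases s <;> cases christoffelStep p (p + q) (j + 1) <;> simp <;> omega
      · omega
  · rw [snakeTriangle_odd, snakeRel_odd, snakePoint, pt_mem_downTriangle]
    dsimp only
    by_cases hj : j = k
    · subst hj
      have := s.toNat_le
      simp only [true_or, true_iff]
      omega
    · by_cases hj' : j = k + 1
      · subst hj'
        rw [crossing_succ (by omega) (by omega) (k + 1)]
        cases s <;> cases christoffelStep p (p + q) (k + 1) <;> simp <;> omega
      · omega

lemma snakePoint_mem_stripVertices {p q : ℕ} (hp : 0 < p) (hq : 0 < q) (h : p.Coprime q)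
    {b : ℕ × Bool} (hb : b.1 < p + q - 1) :
    snakePoint p (p + q) b ∈ stripVertices (pt p q) \ {0, pt p q} := by
  refine ⟨⟨_, snakeTriangle_mem hp hq h (i := 2 * b.1) (by omega), ?_⟩, ?_⟩
  · rw [← snakePoint_mem_snakeTriangle hp, snakeRel_even]
    exact Or.inl rfl
  · simp only [Set.mem_insert_iff, Set.mem_singleton_iff, zero_eq_pt, snakePoint, pt_inj]
    omega

lemma exists_snakePoint {p q : ℕ} (hp : 0 < p) (hq : 0 < q) {x : TriLattice}
    (hx : x ∈ stripVertices (pt p q) \ {0, pt p q}) :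
    ∃ b ∈ snakeBlocks (p + q - 1), snakePoint p (p + q) b = x := by
  obtain ⟨⟨t, ht, hxt⟩, hx'⟩ := hx
  obtain ⟨i, hi, rfl⟩ := exists_snakeTriangle hp hq ht
  obtain ⟨x, y, rfl⟩ := exists_eq_pt x
  simp only [Set.mem_insert_iff, Set.mem_singleton_iff, zero_eq_pt, pt_inj, not_or] at hx'
  simp only [mem_snakeBlocks, snakePoint, pt_inj]
  rcases Nat.even_or_odd' i with ⟨k, rfl | rfl⟩
  · rw [snakeTriangle_even, pt_mem_upTriangle] at hxt
    rcases hxt with ⟨rfl, rfl⟩ | ⟨rfl, rfl⟩ | ⟨rfl, rfl⟩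
    -- The corner of the first lower triangle is the origin, which is excluded; every other lower
    -- corner is an endpoint of the preceding crossed edge.
    · rcases Nat.eq_zero_or_pos k with rfl | hk
      · have : (0 + 1) * p / (p + q) = 0 := Nat.div_eq_of_lt (by omega)
        rw [this] at hx'
        simp at hx'
      · obtain ⟨j, rfl⟩ : ∃ j, k = j + 1 := ⟨k - 1, by omega⟩
        refine ⟨(j, christoffelStep p (p + q) (j + 1)), by simp only; omega, ?_⟩
        have := crossing_succ (show 0 < p + q by omega) (show p ≤ p + q by omega) (j + 1)
        simp only
        omega
    · exact ⟨(k, true), by simp only; omega, by simp; ring⟩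
    · exact ⟨(k, false), by simp only; omega, by simp; ring⟩
  · rw [snakeTriangle_odd, pt_mem_downTriangle] at hxt
    rcases hxt with ⟨rfl, rfl⟩ | ⟨rfl, rfl⟩ | ⟨rfl, rfl⟩
    · rcases Nat.lt_or_ge (k + 1) (p + q - 1) with hk | hk
      · refine ⟨(k + 1, !christoffelStep p (p + q) (k + 1)), hk, ?_⟩
        have := crossing_succ (show 0 < p + q by omega) (show p ≤ p + q by omega) (k + 1)
        simp only
        rw [this]
        cases christoffelStep p (p + q) (k + 1) <;> simp <;> ring
      -- The corner of the last upper triangle is `pt p q` itself, also excluded.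
      · have hk' : k + 1 = p + q - 1 := by omega
        have : (k + 1) * p / (p + q) = p - 1 := by
          obtain ⟨a, rfl⟩ : ∃ a, p = a + 1 := ⟨p - 1, by omega⟩
          have e : k + 1 = a + q := by omega
          rw [e]
          apply Nat.div_eq_of_lt_le
          · simp only [Nat.add_sub_cancel]; nlinarith
          · simp only [Nat.add_sub_cancel]; nlinarith
        rw [this] at hx'
        omega
    · exact ⟨(k, false), by simp only; omega, by simp⟩
    · exact ⟨(k, true), by simp only; omega, by simp⟩

/-! ### The matching number in the first sextant -/

lemma not_isShortest_pt {p q : ℕ} (hp : 0 < p) (hq : 0 < q) : ¬ IsShortest (pt p q) := by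
  rw [isShortest_pt]; omega

lemma M_eq_card {u : TriLattice} (hu : ¬ IsShortest u) :
    M u = Nat.card {e : stripTriangles u ≃ ↥(stripVertices u \ {0, u}) //
      ∀ t : stripTriangles u, (e t : TriLattice) ∈ (t : Finset TriLattice)} := by
  rw [M, if_neg hu]
  exact ncard_isPerfectMatching _ _

lemma M_pt_of_pos {p q : ℕ} (hp : 0 < p) (hq : 0 < q) (h : p.Coprime q) :
    (M (pt p q) : ℤ) = cohnEntry p q := by
  rw [← matchingCount_eq_cohnEntry hp hq, M_eq_card (not_isShortest_pt hp hq),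
    ← card_equiv_eq_matchingCount]
  congr 1
  symm
  let φ : Fin (2 * (p + q - 1)) ≃ stripTriangles (pt p q) :=
    Equiv.ofBijective (fun i => ⟨snakeTriangle p (p + q) i, snakeTriangle_mem hp hq h i.2⟩)
      ⟨fun i j hij => Fin.ext (snakeTriangle_injective _ _ (congrArg Subtype.val hij)), by
        rintro ⟨t, ht⟩
        obtain ⟨i, hi, rfl⟩ := exists_snakeTriangle hp hq ht
        exact ⟨⟨i, hi⟩, rfl⟩⟩
  let ψ : snakeBlocks (p + q - 1) ≃ ↥(stripVertices (pt p q) \ {0, pt p q}) :=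
    Equiv.ofBijective (fun b => ⟨snakePoint p (p + q) b,
        snakePoint_mem_stripVertices hp hq h (mem_snakeBlocks.1 b.2)⟩)
      ⟨fun a b hab => Subtype.ext (snakePoint_injective _ _ (congrArg Subtype.val hab)), by
        rintro ⟨x, hx⟩
        obtain ⟨b, hb, rfl⟩ := exists_snakePoint hp hq hx
        exact ⟨⟨b, hb⟩, rfl⟩⟩
  exact card_equiv_congr φ ψ (R := fun i b => snakeRel _ i b)
    (R' := fun t x => (x : TriLattice) ∈ (t : Finset TriLattice))
    fun i b => snakePoint_mem_snakeTriangle hp b.1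

/-- The matching number of a vector of the first sextant is the entry of its Cohn matrix. -/
theorem M_pt {p q : ℕ} (h : p.Coprime q) : (M (pt p q) : ℤ) = cohnEntry p q := by
  rcases Nat.eq_zero_or_pos p with rfl | hp
  · obtain rfl : q = 1 := by simpa using h
    rw [M, if_pos (isShortest_pt.2 (by simp)), cohnEntry_zero_one]; rfl
  rcases Nat.eq_zero_or_pos q with rfl | hq
  · obtain rfl : p = 1 := by simpa using h
    rw [M, if_pos (isShortest_pt.2 (by simp)), cohnEntry_one_zero]; rfl
  exact M_pt_of_pos hp hq h

/-! ### Symmetries of the lattice -/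

section Symmetry

variable {σ : TriLattice ≃+ TriLattice} {L : (Fin 3 → ℝ) ≃ₗ[ℝ] (Fin 3 → ℝ)}

lemma isShortest_map (hσ : ∀ p, sqLength (σ p) = sqLength p) (u : TriLattice) :
    IsShortest (σ u) ↔ IsShortest u := by
  rw [isShortest_iff_sqLength, isShortest_iff_sqLength, hσ]

lemma map_mem_stripTriangles (hL : ∀ p, toReal (σ p) = L (toReal p))
    (hσ : ∀ p, sqLength (σ p) = sqLength p) {u : TriLattice} {t : Finset TriLattice}
    (ht : t ∈ stripTriangles u) : t.map σ.toEquiv.toEmbedding ∈ stripTriangles (σ u) := by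
  refine ⟨⟨by rw [Finset.card_map]; exact ht.1.1, ?_⟩, ?_⟩
  · intro p hp q hq hpq
    obtain ⟨p', hp', rfl⟩ := Finset.mem_map.1 hp
    obtain ⟨q', hq', rfl⟩ := Finset.mem_map.1 hq
    have : IsShortest (σ (p' - q')) :=
      (isShortest_map hσ _).2 (ht.1.2 p' hp' q' hq' fun h => hpq (by rw [h]))
    rwa [map_sub] at this
  · obtain ⟨s, h0, h1, c, hc, hc1, hs⟩ := segment_inter_nonempty.1 ht.2
    refine segment_inter_nonempty.2 ⟨s, h0, h1, fun p => c (σ.symm p), ?_, ?_, ?_⟩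
    · intro p hp
      obtain ⟨p', hp', rfl⟩ := Finset.mem_map.1 hp
      simpa using hc p' hp'
    · simpa using hc1
    · rw [hL, ← map_smul, hs]
      simp [hL]

lemma symm_toReal (hL : ∀ p, toReal (σ p) = L (toReal p)) (p : TriLattice) :
    toReal (σ.symm p) = L.symm (toReal p) := by
  rw [LinearEquiv.eq_symm_apply, ← hL, AddEquiv.apply_symm_apply]

lemma symm_sqLength (hσ : ∀ p, sqLength (σ p) = sqLength p) (p : TriLattice) :
    sqLength (σ.symm p) = sqLength p := by
  rw [← hσ, AddEquiv.apply_symm_apply]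

lemma map_mem_stripTriangles_iff (hL : ∀ p, toReal (σ p) = L (toReal p))
    (hσ : ∀ p, sqLength (σ p) = sqLength p) {u : TriLattice} {t : Finset TriLattice} :
    t ∈ stripTriangles u ↔ t.map σ.toEquiv.toEmbedding ∈ stripTriangles (σ u) := by
  refine ⟨map_mem_stripTriangles hL hσ, fun h => ?_⟩
  have := map_mem_stripTriangles (symm_toReal hL) (symm_sqLength hσ) h
  rw [AddEquiv.symm_apply_apply, Finset.map_map] at this
  convert this
  ext p
  simp

lemma map_mem_stripVertices_iff (hL : ∀ p, toReal (σ p) = L (toReal p))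
    (hσ : ∀ p, sqLength (σ p) = sqLength p) {u p : TriLattice} :
    p ∈ stripVertices u ↔ σ p ∈ stripVertices (σ u) := by
  constructor
  · rintro ⟨t, ht, hp⟩
    exact ⟨_, map_mem_stripTriangles hL hσ ht, Finset.mem_map.2 ⟨p, hp, rfl⟩⟩
  · rintro ⟨t, ht, hp⟩
    have := map_mem_stripTriangles (symm_toReal hL) (symm_sqLength hσ) ht
    rw [AddEquiv.symm_apply_apply] at this
    exact ⟨_, this, Finset.mem_map.2 ⟨σ p, hp, by simp⟩⟩

/-- The matching number is invariant under the symmetries of the lattice. -/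
theorem M_map (hL : ∀ p, toReal (σ p) = L (toReal p)) (hσ : ∀ p, sqLength (σ p) = sqLength p)
    (u : TriLattice) : M (σ u) = M u := by
  by_cases hu : IsShortest u
  · rw [M, M, if_pos hu, if_pos ((isShortest_map hσ u).2 hu)]
  · rw [M_eq_card hu, M_eq_card (mt (isShortest_map hσ u).1 hu)]
    symm
    let φ : stripTriangles u ≃ stripTriangles (σ u) :=
      (Equiv.finsetCongr σ.toEquiv).subtypeEquiv fun t => map_mem_stripTriangles_iff hL hσ
    let ψ : ↥(stripVertices u \ {0, u}) ≃ ↥(stripVertices (σ u) \ {0, σ u}) :=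
      σ.toEquiv.subtypeEquiv fun p => by
        simp [map_mem_stripVertices_iff hL hσ (u := u) (p := p)]
    refine card_equiv_congr φ ψ
      (R := fun t x => (x : TriLattice) ∈ (t : Finset TriLattice))
      (R' := fun t x => (x : TriLattice) ∈ (t : Finset TriLattice)) fun t b => ?_
    exact (Finset.mem_map' σ.toEquiv.toEmbedding).symm

end Symmetry

lemma M_neg (u : TriLattice) : M (-u) = M u := by
  refine M_map (σ := AddEquiv.neg TriLattice) (L := LinearEquiv.neg ℝ) ?_ ?_ u
  · intro p
    ext i
    simp [toReal]
  · intro p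
    simp [sqLength]

/-- The rotation of the lattice by a third of a turn. -/
def rotate : TriLattice ≃+ TriLattice where
  toFun p := ⟨fun i => (p : Fin 3 → ℤ) (i + 1), by
    change (p : Fin 3 → ℤ) 1 + (p : Fin 3 → ℤ) 2 + (p : Fin 3 → ℤ) 0 = 0
    linarith [sum_eq_zero p]⟩
  invFun p := ⟨fun i => (p : Fin 3 → ℤ) (i - 1), by
    change (p : Fin 3 → ℤ) 2 + (p : Fin 3 → ℤ) 0 + (p : Fin 3 → ℤ) 1 = 0
    linarith [sum_eq_zero p]⟩
  left_inv p := by ext i; simp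
  right_inv p := by ext i; simp
  map_add' p q := rfl

@[simp] lemma rotate_apply (p : TriLattice) (i : Fin 3) :
    (rotate p : Fin 3 → ℤ) i = (p : Fin 3 → ℤ) (i + 1) := rfl

lemma M_rotate (u : TriLattice) : M (rotate u) = M u := by
  refine M_map (σ := rotate) (L := LinearEquiv.funCongrLeft ℝ ℝ (Equiv.addRight 1)) ?_ ?_ u
  · intro p
    ext i
    simp [toReal, LinearMap.funLeft]
  · intro p
    simp only [sqLength, rotate_apply]
    exact Equiv.sum_comp (Equiv.addRight (1 : Fin 3)) fun i => (p : Fin 3 → ℤ) i ^ 2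

/-! ### Determinants, bases and superbases -/

/-- The determinant of two lattice vectors. -/
def latticeDet (u v : TriLattice) : ℤ :=
  (u : Fin 3 → ℤ) 0 * (v : Fin 3 → ℤ) 1 - (u : Fin 3 → ℤ) 1 * (v : Fin 3 → ℤ) 0

lemma latticeDet_pt (x y x' y' : ℤ) : latticeDet (pt x y) (pt x' y') = x * y' - y * x' := by
  simp [latticeDet]

lemma isUnit_latticeDet_symm {u v : TriLattice} (h : IsUnit (latticeDet u v)) :
    IsUnit (latticeDet v u) := by
  rw [← IsUnit.neg_iff]
  convert h using 1
  unfold latticeDet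
  ring

lemma isUnit_latticeDet_rotate {u v : TriLattice} (h : IsUnit (latticeDet u v)) :
    IsUnit (latticeDet (rotate u) (rotate v)) := by
  convert h using 1
  obtain ⟨x, y, rfl⟩ := exists_eq_pt u
  obtain ⟨x', y', rfl⟩ := exists_eq_pt v
  simp [latticeDet]
  ring

lemma FormBasis.isUnit_latticeDet {u v : TriLattice} (h : FormBasis u v) :
    IsUnit (latticeDet u v) := by
  obtain ⟨b, hb⟩ := h
  have key : ∀ w, ∃ r s : ℤ, w = r • u + s • v := by
    intro w
    refine ⟨b.repr w 0, b.repr w 1, ?_⟩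
    conv_lhs => rw [← b.sum_repr w]
    simp [Fin.sum_univ_two, hb]
  obtain ⟨x, y, rfl⟩ := exists_eq_pt u
  obtain ⟨x', y', rfl⟩ := exists_eq_pt v
  obtain ⟨r, s, h1⟩ := key (pt 1 0)
  obtain ⟨r', s', h2⟩ := key (pt 0 1)
  rw [smul_pt, smul_pt, pt_add, pt_inj] at h1 h2
  rw [latticeDet_pt]
  refine IsUnit.of_mul_eq_one (r * s' - s * r') ?_
  linear_combination (-1 : ℤ) * h1.1 * (r' * y + s' * y') + h1.2 * (r' * x + s' * x') - h2.2

lemma formBasis_of_isUnit {u v : TriLattice} (h : IsUnit (latticeDet u v)) : FormBasis u v := by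
  have hD : latticeDet u v * latticeDet u v = 1 := Int.isUnit_mul_self h
  obtain ⟨x, y, rfl⟩ := exists_eq_pt u
  obtain ⟨x', y', rfl⟩ := exists_eq_pt v
  rw [latticeDet_pt] at hD
  have hli : LinearIndependent ℤ ![pt x y, pt x' y'] := by
    rw [LinearIndependent.pair_iff]
    intro r s hrs
    rw [smul_pt, smul_pt, pt_add, zero_eq_pt, pt_inj] at hrs
    constructor
    · linear_combination (-r) * hD + (x * y' - y * x') * (y' * hrs.1 - x' * hrs.2)
    · linear_combination (-s) * hD + (x * y' - y * x') * (x * hrs.2 - y * hrs.1)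
  have hsp : ⊤ ≤ Submodule.span ℤ (Set.range ![pt x y, pt x' y']) := by
    intro w _
    obtain ⟨a, b, rfl⟩ := exists_eq_pt w
    -- Cramer's rule, with the determinant serving as its own inverse.
    have : pt a b = ((x * y' - y * x') * (a * y' - b * x')) • pt x y +
        ((x * y' - y * x') * (x * b - y * a)) • pt x' y' := by
      rw [smul_pt, smul_pt, pt_add, pt_inj]
      constructor
      · linear_combination (-a) * hD
      · linear_combination (-b) * hD
    rw [this]
    refine add_mem (Submodule.smul_mem _ _ (Submodule.subset_span ⟨0, rfl⟩))
      (Submodule.smul_mem _ _ (Submodule.subset_span ⟨1, rfl⟩))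
  exact ⟨Module.Basis.mk hli hsp, Module.Basis.coe_mk _ _⟩

lemma isPrimitive_of_isUnit {u v : TriLattice} (h : IsUnit (latticeDet u v)) : IsPrimitive u := by
  rintro k w hk rfl
  have h1 : latticeDet (k • w) v = k * latticeDet w v := by
    simp [latticeDet]; ring
  rw [h1] at h
  have := Int.isUnit_iff.1 (isUnit_of_mul_isUnit_left h)
  omega

lemma IsPrimitive.exists_latticeDet {u : TriLattice} (h : IsPrimitive u) :
    ∃ v, latticeDet u v = 1 := by
  obtain ⟨x, y, rfl⟩ := exists_eq_pt u
  have hg : (Int.gcd x y : ℤ) = 1 := by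
    obtain ⟨a, ha⟩ := Int.gcd_dvd_left x y
    obtain ⟨b, hb⟩ := Int.gcd_dvd_right x y
    by_contra hne
    rcases Nat.eq_zero_or_pos (Int.gcd x y) with h0 | h0
    · rw [h0] at ha hb
      exact h 2 0 (by norm_num) (by rw [ha, hb, zero_eq_pt, smul_pt]; simp)
    · refine h (Int.gcd x y) (pt a b) (by omega) ?_
      rw [smul_pt, ← ha, ← hb]
  have := Int.gcd_eq_gcd_ab x y
  refine ⟨pt (-Int.gcdB x y) (Int.gcdA x y), ?_⟩
  rw [latticeDet_pt]
  linarith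

/-- The relation between the vectors of a lax superbase, with signs as integers. -/
def SignedSumZero (u v w : TriLattice) : Prop :=
  ∃ a b c : ℤ, (a = 1 ∨ a = -1) ∧ (b = 1 ∨ b = -1) ∧ (c = 1 ∨ c = -1) ∧
    a • u + b • v + c • w = 0

/-- Three vectors with unimodular pairs and a signed sum equal to zero. -/
structure IsUnimodularTriple (u v w : TriLattice) : Prop where
  det₁ : IsUnit (latticeDet u v)
  det₂ : IsUnit (latticeDet u w)
  det₃ : IsUnit (latticeDet v w)
  sum : SignedSumZero u v w

lemma IsLaxSuperbase.isUnimodularTriple {u v w : TriLattice} (h : IsLaxSuperbase u v w) :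
    IsUnimodularTriple u v w := by
  obtain ⟨-, -, -, h1, h2, h3, a, b, c, h4⟩ := h
  refine ⟨h1.isUnit_latticeDet, h2.isUnit_latticeDet, h3.isUnit_latticeDet, a, b, c,
    Int.isUnit_iff.1 a.isUnit, Int.isUnit_iff.1 b.isUnit, Int.isUnit_iff.1 c.isUnit, h4⟩

lemma IsUnimodularTriple.isLaxSuperbase {u v w : TriLattice} (h : IsUnimodularTriple u v w) :
    IsLaxSuperbase u v w := by
  obtain ⟨h1, h2, h3, a, b, c, ha, hb, hc, h4⟩ := h
  refine ⟨isPrimitive_of_isUnit h1, isPrimitive_of_isUnit h3,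
    isPrimitive_of_isUnit (isUnit_latticeDet_symm h3), formBasis_of_isUnit h1,
    formBasis_of_isUnit h2, formBasis_of_isUnit h3, (Int.isUnit_iff.2 ha).unit,
    (Int.isUnit_iff.2 hb).unit, (Int.isUnit_iff.2 hc).unit, h4⟩

lemma IsUnimodularTriple.swap₁₂ {u v w : TriLattice} (h : IsUnimodularTriple u v w) :
    IsUnimodularTriple v u w := by
  obtain ⟨h1, h2, h3, a, b, c, ha, hb, hc, h4⟩ := h
  exact ⟨isUnit_latticeDet_symm h1, h3, h2, b, a, c, hb, ha, hc, by rw [← h4]; abel⟩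

lemma IsUnimodularTriple.swap₂₃ {u v w : TriLattice} (h : IsUnimodularTriple u v w) :
    IsUnimodularTriple u w v := by
  obtain ⟨h1, h2, h3, a, b, c, ha, hb, hc, h4⟩ := h
  exact ⟨h2, h1, isUnit_latticeDet_symm h3, a, c, b, ha, hc, hb, by rw [← h4]; abel⟩

lemma IsUnimodularTriple.rotate {u v w : TriLattice} (h : IsUnimodularTriple u v w) :
    IsUnimodularTriple (rotate u) (rotate v) (rotate w) := by
  obtain ⟨h1, h2, h3, a, b, c, ha, hb, hc, h4⟩ := h
  refine ⟨isUnit_latticeDet_rotate h1, isUnit_latticeDet_rotate h2, isUnit_latticeDet_rotate h3,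
    a, b, c, ha, hb, hc, ?_⟩
  rw [← map_zsmul, ← map_zsmul, ← map_zsmul, ← map_add, ← map_add, h4, map_zero]

lemma isUnimodularTriple_add {u v : TriLattice} (h : IsUnit (latticeDet u v)) :
    IsUnimodularTriple u v (u + v) := by
  refine ⟨h, ?_, ?_, 1, 1, -1, by simp, by simp, by simp, by simp; abel⟩
  · convert h using 1
    simp [latticeDet]; ring
  · convert isUnit_latticeDet_symm h using 1
    simp [latticeDet]; ring

lemma IsMarkoffTriple.swap₁₂ {x y z : ℕ} (h : IsMarkoffTriple x y z) : IsMarkoffTriple y x z := by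
  obtain ⟨h1, h2, h3, h4⟩ := h
  exact ⟨h2, h1, h3, by linarith⟩

lemma IsMarkoffTriple.swap₂₃ {x y z : ℕ} (h : IsMarkoffTriple x y z) : IsMarkoffTriple x z y := by
  obtain ⟨h1, h2, h3, h4⟩ := h
  exact ⟨h1, h3, h2, by linarith⟩

/-! ### From superbases to Markoff triples -/

lemma coprime_of_farey {p q p' q' : ℕ} (h : q * p' = p * q' + 1) :
    p.Coprime q ∧ p'.Coprime q' ∧ (p + p').Coprime (q + q') := by
  have h' : (q : ℤ) * p' = p * q' + 1 := by exact_mod_cast h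
  refine ⟨?_, ?_, ?_⟩ <;> rw [← Nat.isCoprime_iff_coprime]
  · exact ⟨-q', p', by linarith⟩
  · exact ⟨q, -p, by linarith⟩
  · exact ⟨-q', p', by push_cast; linarith⟩

/-- Pairs of vectors of the first sextant that form a basis of the lattice. -/
def IsFareyPair (p q p' q' : ℕ) : Prop := q * p' = p * q' + 1 ∨ q' * p = p' * q + 1

lemma isFareyPair_iff {p q p' q' : ℕ} :
    IsFareyPair p q p' q' ↔ IsUnit (latticeDet (pt p q) (pt p' q')) := by
  rw [latticeDet_pt, Int.isUnit_iff, IsFareyPair]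
  zify
  constructor
  · rintro (h | h)
    · right; linarith
    · left; linarith
  · rintro (h | h)
    · right; linarith
    · left; linarith

lemma IsFareyPair.symm {p q p' q' : ℕ} (h : IsFareyPair p q p' q') : IsFareyPair p' q' p q :=
  Or.symm h

lemma IsFareyPair.coprime {p q p' q' : ℕ} (h : IsFareyPair p q p' q') :
    p.Coprime q ∧ p'.Coprime q' ∧ (p + p').Coprime (q + q') := by
  rcases h with h | h
  · exact coprime_of_farey h
  · obtain ⟨h1, h2, h3⟩ := coprime_of_farey h
    exact ⟨h2, h1, by rwa [add_comm p, add_comm q]⟩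

lemma IsFareyPair.isMarkoffTriple {p q p' q' : ℕ} (h : IsFareyPair p q p' q') :
    IsMarkoffTriple (M (pt p q)) (M (pt p' q')) (M (pt (p + p' : ℕ) (q + q' : ℕ))) := by
  obtain ⟨h1, h2, h3⟩ := h.coprime
  have pos : ∀ {p q : ℕ}, p.Coprime q → 0 < M (pt p q) := fun {p q} h => by
    zify
    rw [M_pt h]
    refine cohnEntry_pos (Nat.pos_of_ne_zero fun h0 => ?_)
    obtain ⟨rfl, rfl⟩ : p = 0 ∧ q = 0 := by omega
    simp at h
  refine ⟨pos h1, pos h2, pos h3, ?_⟩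
  zify
  rw [M_pt h1, M_pt h2, ← Nat.cast_add, ← Nat.cast_add, M_pt h3]
  rcases h with h | h
  · exact cohnEntry_markoff _ _ _ _ h
  · rw [add_comm p, add_comm q]
    linarith [cohnEntry_markoff _ _ _ _ h]

/-- The closed first sextant and its opposite. -/
def InSextant (u : TriLattice) : Prop := 0 ≤ (u : Fin 3 → ℤ) 0 * (u : Fin 3 → ℤ) 1

lemma InSextant.exists_eq {u : TriLattice} (h : InSextant u) :
    ∃ (p q : ℕ) (a : ℤ), (a = 1 ∨ a = -1) ∧ u = a • pt p q := by
  obtain ⟨x, y, rfl⟩ := exists_eq_pt u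
  have h' : 0 ≤ x * y := h
  rcases mul_nonneg_iff.1 h' with ⟨h1, h2⟩ | ⟨h1, h2⟩
  · refine ⟨x.toNat, y.toNat, 1, Or.inl rfl, ?_⟩
    rw [one_smul, Int.toNat_of_nonneg h1, Int.toNat_of_nonneg h2]
  · refine ⟨(-x).toNat, (-y).toNat, -1, Or.inr rfl, ?_⟩
    rw [smul_pt, Int.toNat_of_nonneg (by omega), Int.toNat_of_nonneg (by omega)]
    simp

lemma M_sign_smul {a : ℤ} (ha : a = 1 ∨ a = -1) (u : TriLattice) : M (a • u) = M u := by
  rcases ha with rfl | rfl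
  · rw [one_smul]
  · rw [neg_one_smul, M_neg]

lemma isUnit_latticeDet_smul {a b : ℤ} {u v : TriLattice}
    (h : IsUnit (latticeDet (a • u) (b • v))) : IsUnit (latticeDet u v) := by
  have : latticeDet (a • u) (b • v) = (a * b) * latticeDet u v := by
    simp [latticeDet]; ring
  rw [this] at h
  exact isUnit_of_mul_isUnit_right h

lemma IsUnimodularTriple.isMarkoffTriple_of_inSextant {u v w : TriLattice}
    (h : IsUnimodularTriple u v w) (hu : InSextant u) (hv : InSextant v) (hw : InSextant w) :
    IsMarkoffTriple (M u) (M v) (M w) := by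
  obtain ⟨p, q, a, ha, rfl⟩ := hu.exists_eq
  obtain ⟨p', q', a', ha', rfl⟩ := hv.exists_eq
  obtain ⟨p'', q'', a'', ha'', rfl⟩ := hw.exists_eq
  rw [M_sign_smul ha, M_sign_smul ha', M_sign_smul ha'']
  have h1 := isFareyPair_iff.2 (isUnit_latticeDet_smul h.det₁)
  have h2 := isFareyPair_iff.2 (isUnit_latticeDet_smul h.det₂)
  have h3 := isFareyPair_iff.2 (isUnit_latticeDet_smul h.det₃)
  obtain ⟨b, b', b'', hb, hb', hb'', hs⟩ := h.sum
  -- With nonnegative coordinates a signed sum can vanish only if one vector is the sum of the other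
  -- two or all are zero; the last alternative contradicts unimodularity.
  have key : (p'' = p + p' ∧ q'' = q + q') ∨ (p' = p + p'' ∧ q' = q + q'') ∨
      (p = p' + p'' ∧ q = q' + q'') ∨ (p = 0 ∧ q = 0) := by
    simp only [smul_pt, pt_add, zero_eq_pt, pt_inj] at hs
    rcases ha with rfl | rfl <;> rcases ha' with rfl | rfl <;> rcases ha'' with rfl | rfl <;>
    rcases hb with rfl | rfl <;> rcases hb' with rfl | rfl <;> rcases hb'' with rfl | rfl <;>
    omega
  rcases key with ⟨rfl, rfl⟩ | ⟨rfl, rfl⟩ | ⟨rfl, rfl⟩ | ⟨rfl, rfl⟩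
  · exact h1.isMarkoffTriple
  · exact h2.isMarkoffTriple.swap₂₃
  · exact h3.isMarkoffTriple.swap₂₃.swap₁₂
  · simp [IsFareyPair] at h1

/-- Were `v` outside, the products `x * y'` and `y * x'` would have opposite signs, yet they are
consecutive integers, whose product is never negative. -/
lemma inSextant_of_isUnit {u v : TriLattice} (h : IsUnit (latticeDet u v))
    (hu : 0 < (u : Fin 3 → ℤ) 0 * (u : Fin 3 → ℤ) 1) : InSextant v := by
  unfold InSextant
  unfold latticeDet at h
  generalize (u : Fin 3 → ℤ) 0 = x at *
  generalize (u : Fin 3 → ℤ) 1 = y at *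
  generalize (v : Fin 3 → ℤ) 0 = x' at *
  generalize (v : Fin 3 → ℤ) 1 = y' at *
  by_contra! hv
  have h1 : (x * y') * (y * x') < 0 := by nlinarith
  generalize x * y' = A at *
  generalize y * x' = B at *
  rcases Int.isUnit_iff.1 h with h | h
  · obtain rfl : A = B + 1 := by omega
    rcases le_or_gt 0 B with hB | hB <;> nlinarith
  · obtain rfl : A = B - 1 := by omega
    rcases le_or_gt B 0 with hB | hB <;> nlinarith

lemma IsUnimodularTriple.isMarkoffTriple_of_pos {u v w : TriLattice}
    (h : IsUnimodularTriple u v w) (hu : 0 < (u : Fin 3 → ℤ) 0 * (u : Fin 3 → ℤ) 1) :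
    IsMarkoffTriple (M u) (M v) (M w) :=
  h.isMarkoffTriple_of_inSextant hu.le (inSextant_of_isUnit h.det₁ hu)
    (inSextant_of_isUnit h.det₂ hu)

/-- Three nonzero coordinates with sum zero include two of the same sign, and at most two rotations
make these the first two. -/
lemma IsUnimodularTriple.isMarkoffTriple_of_ne_zero {u v w : TriLattice}
    (h : IsUnimodularTriple u v w) (hu : ∀ i, (u : Fin 3 → ℤ) i ≠ 0) :
    IsMarkoffTriple (M u) (M v) (M w) := by
  have key : 0 < (u : Fin 3 → ℤ) 0 * (u : Fin 3 → ℤ) 1 ∨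
      0 < (u : Fin 3 → ℤ) 1 * (u : Fin 3 → ℤ) 2 ∨ 0 < (u : Fin 3 → ℤ) 2 * (u : Fin 3 → ℤ) 0 := by
    have h0 := hu 0
    have h1 := hu 1
    have h2 := hu 2
    simp only [mul_pos_iff]
    omega
  rcases key with hu | hu | hu
  · exact h.isMarkoffTriple_of_pos hu
  · rw [← M_rotate u, ← M_rotate v, ← M_rotate w]
    exact h.rotate.isMarkoffTriple_of_pos hu
  · rw [← M_rotate u, ← M_rotate v, ← M_rotate w, ← M_rotate (MarkoffSnake.rotate u),
      ← M_rotate (MarkoffSnake.rotate v), ← M_rotate (MarkoffSnake.rotate w)]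
    exact h.rotate.rotate.isMarkoffTriple_of_pos hu

/-- On a coordinate line `u` is a multiple of a shortest vector, and the factor divides a unit. -/
lemma M_eq_one_of_isUnit {u v : TriLattice} (h : IsUnit (latticeDet u v))
    (hu : ∃ i, (u : Fin 3 → ℤ) i = 0) : M u = 1 := by
  rw [M, if_pos]
  obtain ⟨x, y, rfl⟩ := exists_eq_pt u
  obtain ⟨x', y', rfl⟩ := exists_eq_pt v
  rw [latticeDet_pt] at h
  rw [isShortest_pt]
  obtain ⟨i, hi⟩ := hu
  fin_cases i
  · obtain rfl : x = 0 := hi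
    have := Int.isUnit_iff.1 (isUnit_of_mul_isUnit_left (x := y) (y := -x') (by simpa using h))
    omega
  · obtain rfl : y = 0 := hi
    have := Int.isUnit_iff.1 (isUnit_of_mul_isUnit_left (x := x) (y := y') (by simpa using h))
    omega
  · obtain rfl : y = -x := by
      have : -x - y = 0 := hi
      omega
    have := Int.isUnit_iff.1 (isUnit_of_mul_isUnit_left (x := x) (y := x' + y')
      (by convert h using 1; ring))
    omega

theorem IsUnimodularTriple.isMarkoffTriple {u v w : TriLattice} (h : IsUnimodularTriple u v w) :
    IsMarkoffTriple (M u) (M v) (M w) := by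
  by_cases hu : ∀ i, (u : Fin 3 → ℤ) i ≠ 0
  · exact h.isMarkoffTriple_of_ne_zero hu
  by_cases hv : ∀ i, (v : Fin 3 → ℤ) i ≠ 0
  · exact (h.swap₁₂.isMarkoffTriple_of_ne_zero hv).swap₁₂
  by_cases hw : ∀ i, (w : Fin 3 → ℤ) i ≠ 0
  · exact (h.swap₂₃.swap₁₂.isMarkoffTriple_of_ne_zero hw).swap₁₂.swap₂₃
  push Not at hu hv hw
  rw [M_eq_one_of_isUnit h.det₁ hu, M_eq_one_of_isUnit h.det₃ hv,
    M_eq_one_of_isUnit (isUnit_latticeDet_symm h.det₃) hw]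
  simp [IsMarkoffTriple]

/-! ### Descent from Markoff triples to Farey pairs -/

lemma IsFareyPair.add {p q p' q' : ℕ} (h : IsFareyPair p q p' q') :
    IsFareyPair p q (p + p') (q + q') := by
  rcases h with h | h
  · left; linarith
  · right; linarith

lemma IsFareyPair.cohnEntry_add {p q p' q' : ℕ} (h : IsFareyPair p q p' q') :
    cohnEntry (p + (p + p')) (q + (q + q')) =
      3 * cohnEntry p q * cohnEntry (p + p') (q + q') - cohnEntry p' q' := by
  rcases h with h | h
  · exact cohnEntry_add_left h
  · have := cohnEntry_add_right h
    rwa [add_comm p' p, add_comm q' q, add_comm _ p, add_comm _ q] at this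

/-- Every Markoff triple other than `(1, 1, 1)` comes from a Farey pair. -/
lemma exists_fareyPair (N : ℕ) : ∀ x y z : ℤ, 0 < x → 0 < y → 0 < z → x ≤ z → y ≤ z → z ≤ N →
    1 < z → x ^ 2 + y ^ 2 + z ^ 2 = 3 * x * y * z → ∃ p q p' q', IsFareyPair p q p' q' ∧
      cohnEntry p q = x ∧ cohnEntry p' q' = y ∧ cohnEntry (p + p') (q + q') = z := by
  induction N with
  | zero => intros; omega
  | succ N ih =>
    have main : ∀ x y z : ℤ, 0 < x → 0 < y → 0 < z → x ≤ y → y ≤ z → z ≤ (N + 1 : ℕ) →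
        1 < z → x ^ 2 + y ^ 2 + z ^ 2 = 3 * x * y * z → ∃ p q p' q', IsFareyPair p q p' q' ∧
        cohnEntry p q = x ∧ cohnEntry p' q' = y ∧ cohnEntry (p + p') (q + q') = z := by
      intro x y z hx hy hz hxy hyz hzN hz1 h
      rcases Int.lt_or_le 1 y with hy1 | hy1
      · have e : z * (3 * x * y - z) = x ^ 2 + y ^ 2 := by linarith
        have hpos : 0 < 3 * x * y - z := by
          refine pos_of_mul_pos_right ?_ hz.le
          rw [e]; positivity
        -- The roots of Markoff's equation in its last variable are `z` and `3 * x * y - z`. The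
        -- quadratic is negative at `y`, so `y` lies strictly between them and becomes the new
        -- maximum.
        have hneg : (z - y) * (y - (3 * x * y - z)) > 0 := by
          have : (z - y) * (y - (3 * x * y - z)) = 3 * x * y ^ 2 - 2 * y ^ 2 - x ^ 2 := by
            linear_combination h
          rw [this]
          have h1 : x ^ 2 ≤ x * y := by nlinarith
          have h2 : x * y * 2 ≤ x * y * y := by
            apply mul_le_mul_of_nonneg_left (by omega) (by positivity)
          nlinarith [mul_pos hx hy, mul_le_mul_of_nonneg_right (show 1 ≤ x by omega)
            (sq_nonneg y)]
        have hlt : 3 * x * y - z < y := by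
          have := pos_of_mul_pos_right hneg (by omega)
          omega
        have hyz' : y < z := by
          have := pos_of_mul_pos_left hneg (by omega)
          omega
        obtain ⟨p, q, p', q', hf, h1, h2, h3⟩ := ih x (3 * x * y - z) y hx hpos hy hxy hlt.le
          (by push_cast at hzN; omega) hy1 (by linear_combination h)
        refine ⟨p, q, p + p', q + q', hf.add, h1, h3, ?_⟩
        rw [hf.cohnEntry_add, h1, h2, h3]
        ring
      · obtain rfl : y = 1 := by omega
        obtain rfl : x = 1 := by omega
        have h2 : (z - 1) * (z - 2) = 0 := by linarith
        obtain rfl : z = 2 := by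
          rcases mul_eq_zero.1 h2 with h3 | h3 <;> omega
        exact ⟨0, 1, 1, 0, Or.inl rfl, cohnEntry_zero_one, cohnEntry_one_zero, cohnEntry_one_one⟩
    intro x y z hx hy hz hxz hyz hzN hz1 h
    rcases le_total x y with hxy | hxy
    · exact main x y z hx hy hz hxy hyz hzN hz1 h
    · obtain ⟨p, q, p', q', hf, h1, h2, h3⟩ :=
        main y x z hy hx hz hxy hxz hzN hz1 (by linarith)
      exact ⟨p', q', p, q, hf.symm, h2, h1, by rw [add_comm p', add_comm q', h3]⟩

lemma IsMarkoffTriple.exists_of_max {x y z : ℕ} (h : IsMarkoffTriple x y z) (hxz : x ≤ z)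
    (hyz : y ≤ z) : ∃ u v w, IsUnimodularTriple u v w ∧ M u = x ∧ M v = y ∧ M w = z := by
  obtain ⟨hx, hy, hz, h⟩ := h
  rcases Nat.lt_or_ge 1 z with hz1 | hz1
  · obtain ⟨p, q, p', q', hf, h1, h2, h3⟩ := exists_fareyPair z x y z (by omega) (by omega)
      (by omega) (by omega) (by omega) le_rfl (by omega) (by exact_mod_cast h)
    obtain ⟨c1, c2, c3⟩ := hf.coprime
    refine ⟨pt p q, pt p' q', pt p q + pt p' q',
      isUnimodularTriple_add (isFareyPair_iff.1 hf), ?_, ?_, ?_⟩ <;> zify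
    · rw [M_pt c1, h1]
    · rw [M_pt c2, h2]
    · rw [pt_add, ← Nat.cast_add, ← Nat.cast_add, M_pt c3, h3]
  · obtain rfl : x = 1 := by omega
    obtain rfl : y = 1 := by omega
    obtain rfl : z = 1 := by omega
    have hM : ∀ x y, IsShortest (pt x y) → M (pt x y) = 1 := fun x y h => by rw [M, if_pos h]
    -- The triple `(1, 1, 1)` needs three shortest vectors, which do not fit in one sextant with
    -- nonnegative coordinates: there `pt 1 0 + pt 0 1` already has matching number two.
    refine ⟨pt 1 0, pt (-1) 1, pt 1 0 + pt (-1) 1, isUnimodularTriple_add ?_, ?_, ?_, ?_⟩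
    · rw [latticeDet_pt]; simp
    · exact hM _ _ (isShortest_pt.2 (by simp))
    · exact hM _ _ (isShortest_pt.2 (by simp))
    · rw [pt_add]
      exact hM _ _ (isShortest_pt.2 (by simp))

theorem IsMarkoffTriple.exists_isUnimodularTriple {x y z : ℕ} (h : IsMarkoffTriple x y z) :
    ∃ u v w, IsUnimodularTriple u v w ∧ M u = x ∧ M v = y ∧ M w = z := by
  by_cases h1 : x ≤ z ∧ y ≤ z
  · exact h.exists_of_max h1.1 h1.2
  by_cases h2 : x ≤ y ∧ z ≤ y
  · obtain ⟨u, v, w, ht, hu, hv, hw⟩ := h.swap₂₃.exists_of_max h2.1 h2.2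
    exact ⟨u, w, v, ht.swap₂₃, hu, hw, hv⟩
  · obtain ⟨u, v, w, ht, hu, hv, hw⟩ :=
      h.swap₁₂.swap₂₃.exists_of_max (show y ≤ x by omega) (show z ≤ x by omega)
    exact ⟨w, u, v, ht.swap₂₃.swap₁₂, hw, hu, hv⟩

end MarkoffSnake

theorem theorem4 :
    (∀ u v w : MarkoffSnake.TriLattice, MarkoffSnake.IsLaxSuperbase u v w →
      MarkoffSnake.IsMarkoffTriple (MarkoffSnake.M u) (MarkoffSnake.M v) (MarkoffSnake.M w)) ∧
    (∀ x y z : ℕ, MarkoffSnake.IsMarkoffTriple x y z →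
      ∃ u v w : MarkoffSnake.TriLattice, MarkoffSnake.IsLaxSuperbase u v w ∧
        MarkoffSnake.M u = x ∧ MarkoffSnake.M v = y ∧ MarkoffSnake.M w = z) ∧
    (∀ u : MarkoffSnake.TriLattice, MarkoffSnake.IsPrimitive u →
      MarkoffSnake.IsMarkoffNumber (MarkoffSnake.M u)) ∧
    (∀ n : ℕ, MarkoffSnake.IsMarkoffNumber n →
      ∃ u : MarkoffSnake.TriLattice, MarkoffSnake.IsPrimitive u ∧ MarkoffSnake.M u = n) := by
  refine ⟨fun u v w h => h.isUnimodularTriple.isMarkoffTriple, fun x y z h => ?_, fun u h => ?_,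
    fun n h => ?_⟩
  · obtain ⟨u, v, w, ht, h⟩ := h.exists_isUnimodularTriple
    exact ⟨u, v, w, ht.isLaxSuperbase, h⟩
  -- Bézout completes a primitive vector `u` to a basis `u, v`, hence to the superbase `u, v, u +
  -- v`.
  · obtain ⟨v, hv⟩ := h.exists_latticeDet
    exact ⟨_, _, _, (MarkoffSnake.isUnimodularTriple_add (hv ▸ isUnit_one)).isMarkoffTriple,
      Or.inl rfl⟩
  · obtain ⟨x, y, z, hm, hn⟩ := h
    obtain ⟨u, v, w, ht, hu, hv, hw⟩ := hm.exists_isUnimodularTriple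
    obtain ⟨h1, h2, h3, -⟩ := ht.isLaxSuperbase
    rcases hn with rfl | rfl | rfl
    · exact ⟨u, h1, hu⟩
    · exact ⟨v, h2, hv⟩
    · exact ⟨w, h3, hw⟩
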